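/- Conventions. Let $L$ be a countable first-order language containing the binary relation symbols $D_r$, $r\in\mathbb Q\cap[0,\infty)$. A \emph{metric $L$-structure} is an $L$-structure $\mathcal X$ with universe $X$ for which there is a (necessarily unique) metric $d$ on $X$ with $\mathcal X\models D_r(x,y)\Leftrightarrow d(x,y)\leqslant r$ for all $r,x,y$, and such that, for the topology of $d$, every function symbol is interpreted by a continuous function $X^k\to X$ and every relation symbol by a closed subset of $X^k$. It is separable or complete if $(X,d)$ is. The automorphism group $\mathrm{Aut}(\mathcal X)$ carries the topology of pointwise convergence on $(X,d)$, for which it is a Polish group if $\mathcal X$ is separable and complete. $\mathcal X$ has the \emph{Hrushovski property} if, for every finite family of isomorphisms $\phi_i\colon \mathcal A_i\to\mathcal B_i$ between finitely generated substructures of $\mathcal X$, there are a finitely generated substructure $\mathcal D\subseteq \mathcal X$ containing all the $\mathcal A_i$ and automorphisms $f_i\in\mathrm{Aut}(\mathcal X)$ such that each $f_i$ extends $\phi_i$ and $f_i[\mathcal D]=\mathcal D$. For substructures $\mathcal A\subseteq\mathcal B\cap\mathcal C$ of $\mathcal X$, \emph{$\mathcal B$ is independent from $\mathcal C$ over $\mathcal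 A$} if, whenever $\phi$ and $\psi$ are automorphisms of $\mathcal B$ and $\mathcal C$, respectively, with $\phi[\mathcal A]=\mathcal A=\psi[\mathcal A]$ and $\phi|_{\mathcal A}=\psi|_{\mathcal A}$, there is an automorphism of the substructure generated by $\mathcal B\cup\mathcal C$ that extends both $\phi$ and $\psi$. $\mathcal X$ has the \emph{extension property} if, for all finitely generated substructures $\mathcal A,\mathcal B,\mathcal C$ of $\mathcal X$ with $\mathcal A\subseteq\mathcal B\cap\mathcal C$, there is $g\in\mathrm{Aut}(\mathcal X)$ that fixes $\mathcal A$ pointwise and such that $\mathcal B$ is independent from $g[\mathcal C]$ over $\mathcal A$. For finite tuples $\overline a,\overline b$ in $X$ and $\epsilon>0$ put $d_\infty(\overline a,\overline b)=\max_i d(a_i,b_i)$ (if the lengths agree), $N(\overline a,\epsilon)=\{g\in\mathrm{Aut}(\mathcal X): d_\infty(g\overline a,\overline a)<\epsilon\}$, $\mathrm{Aut}(\mathcal X,\overline a)=\{g\in \mathrm{Aut}(\mathcal X): g\overline a=\overline a\}$ and $\mathcal O(\overline b/\overline a)=\mathrm{Aut}(\mathcal X,\overline a)\cdot\overline b$.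 A \emph{basis} for $\mathrm{Aut}(\mathcal X)$ is a family $\mathcal B\subseteq\bigcup_{k\geqslant1}X^k$ such that, for every finite non-empty tuple $\overline a$ in $X$ and every $\epsilon>0$, there are $\overline b\in\mathcal B$ and $\eta>0$ with $\mathrm{Aut}(\mathcal X,\overline b)\subseteq\mathrm{Aut}(\mathcal X,\overline a)$ and $N(\overline b,\eta)\subseteq N(\overline a,\epsilon)$. Theorem. Let $\mathcal X$ be a separable complete metric $L$-structure, with $L$ as above, that has the extension and Hrushovski properties, and let $\mathcal B$ be a basis for $\mathrm{Aut}(\mathcal X)$. Suppose that, for all $\overline a\in\mathcal B$ and $\epsilon>0$, the set $$\big\{(g,f)\in N(\overline a,\epsilon)\times\mathrm{Aut}(\mathcal X)\;:\;\mathcal O(\overline a/g\overline a)\cap\mathcal O(f\overline a/\overline a)\neq\emptyset\big\}$$ has non-empty interior in $\mathrm{Aut}(\mathcal X)\times\mathrm{Aut}(\mathcal X)$. Then: (1) whenever $\mathrm{Aut}(\mathcal X)=\bigcup_{n=1}^\infty k_nW_nh_n$ with $k_n,h_n\in\mathrm{Aut}(\mathcal X)$ and $W_n\subseteq\mathrm{Aut}(\mathcal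 X)$, there is some $n$ for which $\big(W_n^{-1}W_n\big)^{32}$ has non-empty interior; (2) $\mathrm{Aut}(\mathcal X)$ is Steinhaus with exponent $64$: if $W=W^{-1}\subseteq\mathrm{Aut}(\mathcal X)$ contains the identity and $\mathrm{Aut}(\mathcal X)=\bigcup_{n=1}^\infty Wf_n$ for some sequence $(f_n)$ in $\mathrm{Aut}(\mathcal X)$, then $W^{64}$ is a neighbourhood of the identity; (3) $\mathrm{Aut}(\mathcal X)$ has the automatic continuity property: every group homomorphism from $\mathrm{Aut}(\mathcal X)$ to a Polish group is continuous. Here $W^m$ denotes the set of all products of $m$ elements of $W$. -/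

import Mathlib

open FirstOrder Set Topology
open scoped Pointwise

universe u v w z

namespace MetricStr

/-! ### Automorphism groups, extension and Hrushovski properties -/

section Algebra

variable (L : FirstOrder.Language.{u, v}) (X : Type w) [L.Structure X]

/-- The automorphism group of a first-order structure. -/
abbrev Aut := X ≃[L] X

/-- Multiplication is composition: `(g * h) x = g (h x)`. -/
instance : Group (Aut L X) where
  mul g h := g.comp h
  one := FirstOrder.Language.Equiv.refl L X
  inv g := g.symm
  mul_assoc _ _ _ := rfl
  one_mul _ := rfl
  mul_one _ := rfl
  inv_mul_cancel g := FirstOrder.Language.Equiv.ext fun x => g.symm_apply_apply x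

theorem Aut.mul_apply (g h : Aut L X) (x : X) : (g * h) x = g (h x) := rfl

theorem Aut.one_apply (x : X) : (1 : Aut L X) x = x := rfl

theorem Aut.inv_eq (g : Aut L X) : g⁻¹ = g.symm := rfl

variable {X}

/-- `φ`, an automorphism of the substructure `B`, leaves `A` (a substructure of `B`) invariant,
that is, `φ[A] = A`. -/
def LeavesInvariant {B : L.Substructure X} (φ : B ≃[L] B) (A : L.Substructure X) : Prop :=
  ∀ b : B, (φ b : X) ∈ A ↔ (b : X) ∈ A

/-- `B` is independent from `C` over `A` (used for `A` contained in `B` and in `C`): automorphisms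
`φ` of `B` and `ψ` of `C` that leave `A` invariant and agree on `A` have a common extension to an
automorphism of the substructure `B ⊔ C` generated by `B ∪ C`. -/
def Indep (B A C : L.Substructure X) : Prop :=
  ∀ (φ : B ≃[L] B) (ψ : C ≃[L] C),
    LeavesInvariant L φ A → LeavesInvariant L ψ A →
    (∀ (b : B) (c : C), (b : X) = (c : X) → (b : X) ∈ A → (φ b : X) = (ψ c : X)) →
    ∃ σ : (B ⊔ C : L.Substructure X) ≃[L] (B ⊔ C : L.Substructure X),
      (∀ (d : (B ⊔ C : L.Substructure X)) (b : B), (d : X) = (b : X) → (σ d : X) = (φ b : X)) ∧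
      (∀ (d : (B ⊔ C : L.Substructure X)) (c : C), (d : X) = (c : X) → (σ d : X) = (ψ c : X))

variable (X)

/-- The extension property of a first-order structure. -/
def ExtensionProperty : Prop :=
  ∀ A B C : L.Substructure X, A.FG → B.FG → C.FG → A ≤ B → A ≤ C →
    ∃ g : Aut L X, (∀ x ∈ A, g x = x) ∧ Indep L B A (C.map g.toHom)

/-- The Hrushovski property of a first-order structure: finitely many isomorphisms `φ i` between
finitely generated substructures extend to automorphisms `f i` which all leave invariant one
finitely generated substructure `D` containing the domains of all the `φ i`. -/
def HrushovskiProperty : Prop :=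
  ∀ (n : ℕ) (A B : Fin n → L.Substructure X), (∀ i, (A i).FG) → (∀ i, (B i).FG) →
    ∀ φ : ∀ i, A i ≃[L] B i,
      ∃ D : L.Substructure X, D.FG ∧ (∀ i, A i ≤ D) ∧
        ∃ f : Fin n → Aut L X, ∀ i,
          (∀ a : A i, f i (a : X) = (φ i a : X)) ∧ D.map (f i).toHom = D

end Algebra

/-! ### Metric structures -/

/-- The relation symbols `D_r`, all binary, indexed by the non-negative rationals. -/
inductive DistRel : ℕ → Type
  | D (r : ℚ≥0) : DistRel 2

/-- The countable relational language `{D_r : r ∈ ℚ, r ≥ 0}`. -/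
def Ldist : FirstOrder.Language.{0, 0} :=
  ⟨fun _ => Empty, DistRel⟩

/-- `X` is a metric `L`-structure with associated metric `dist`, where the language `L` contains
`Ldist` through the injective language map `ι`. -/
structure IsMetricStructure {L : FirstOrder.Language.{u, v}} (ι : Ldist →ᴸ L) (X : Type w)
    [L.Structure X] [MetricSpace X] : Prop where
  injective : ι.Injective
  relMap_dist_iff : ∀ (r : ℚ≥0) (x y : X),
    FirstOrder.Language.Structure.RelMap (ι.onRelation (DistRel.D r)) ![x, y] ↔ dist x y ≤ (r : ℝ)
  continuous_funMap : ∀ (k : ℕ) (F : L.Functions k),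
    Continuous fun x : Fin k → X => FirstOrder.Language.Structure.funMap F x
  isClosed_relMap : ∀ (k : ℕ) (R : L.Relations k),
    IsClosed {x : Fin k → X | FirstOrder.Language.Structure.RelMap R x}

section Topological

variable (L : FirstOrder.Language.{u, v}) {X : Type w} [L.Structure X] [MetricSpace X]

/-- The topology of pointwise convergence on `(X, dist)`. -/
instance : TopologicalSpace (Aut L X) :=
  TopologicalSpace.induced (fun g : Aut L X => (g : X → X)) inferInstance

/-- `N(a, ε) = {g | d_∞(g a, a) < ε}`; the metric on `Fin k → X` is the maximum metric `d_∞`. -/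
def nhd {k : ℕ} (a : Fin k → X) (ε : ℝ) : Set (Aut L X) :=
  {g | dist (fun i => g (a i)) a < ε}

/-- The pointwise stabiliser `Aut(X, a)` of a finite tuple `a`. -/
def stab {k : ℕ} (a : Fin k → X) : Set (Aut L X) :=
  {g | ∀ i, g (a i) = a i}

/-- `O(b / a) = Aut(X, a) · b`. -/
def orbitOver {k l : ℕ} (b : Fin k → X) (a : Fin l → X) : Set (Fin k → X) :=
  {c | ∃ g ∈ stab L a, (fun i => g (b i)) = c}

/-- A family `𝓑` of finite non-empty tuples is a basis for `Aut(X)`. -/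
def IsBasis (𝓑 : Set (Σ k : ℕ, Fin k → X)) : Prop :=
  (∀ b ∈ 𝓑, 1 ≤ b.1) ∧
  ∀ (k : ℕ), 1 ≤ k → ∀ (a : Fin k → X) (ε : ℝ), 0 < ε →
    ∃ b ∈ 𝓑, ∃ η : ℝ, 0 < η ∧ stab L b.2 ⊆ stab L a ∧ nhd L b.2 η ⊆ nhd L a ε

end Topological

/-! ### Steinhaus groups and automatic continuity -/

section Groups

variable (G : Type w) [Group G] [TopologicalSpace G]

variable {G} in
/-- `W` is right `σ`-syndetic: countably many right translates `W f_n` cover the group. -/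
def IsRightSigmaSyndetic (W : Set G) : Prop :=
  ∃ f : ℕ → G, (⋃ n, (fun x => x * f n) '' W) = univ

/-- The group is Steinhaus with exponent `m`. Here `W ^ m` is the set of products of `m` elements
of `W`. -/
def IsSteinhausWithExponent (m : ℕ) : Prop :=
  1 ≤ m ∧ ∀ W : Set G, W⁻¹ = W → (1 : G) ∈ W → IsRightSigmaSyndetic W → W ^ m ∈ 𝓝 (1 : G)

/-- The automatic continuity property: every homomorphism into a Polish group is continuous. -/
def HasAutomaticContinuity : Prop :=
  ∀ (H : Type z) [Group H] [TopologicalSpace H] [IsTopologicalGroup H] [PolishSpace H]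
    (π : G →* H), Continuous π

end Groups

end MetricStr

/-!
The theorem follows the pattern by which ample generics give automatic continuity, applied to a
countable piece of the structure rather than to `Aut X` itself, which need not have ample generics.

*Stabilisers.* Let translates of the sets `W n` cover `G = Aut X`. By a Löwenheim–Skolem argument
there are a countable dense `D ⊆ X` and a countable group `Γ` of automorphisms acting on `D`, closed
under witnesses for the Hrushovski property, for amalgamation (the extension property), and for
the failure of a power of `(W n)⁻¹ * W n` to contain the stabiliser of a finite tuple
(`SkolemSystem`). The limits of `Γ` for pointwise convergence on the discrete set `D` form a Polish
group `Lim`. The Hrushovski property and amalgamation make generic tuples of `Lim` conjugate by a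
back-and-forth argument (`SkolemSystem.ampleGenerics`), and the Cantor scheme of Kechris and
Rosendal (`AmpleGenerics.exists_pow_mem_nhds_one`) shows that for some `n` the sixth power of
`(W n)⁻¹ * W n`, up to conjugation, contains an open subgroup of `Lim`, that is, the stabiliser in
`Lim` of a finite set; by the choice of `D` and `Γ` it contains the stabiliser in `G`. Those `W n`
that are nowhere dense in `G` are avoided by translating `Lim` inside `G`
(`exists_isMeagre_preimage_mul`). This is `exists_stabiliser_subset_pow`.

*From stabilisers to open sets.* As `W n` is somewhere dense, `V = (W n)⁻¹ * W n` is dense near the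
identity. If `S` is the stabiliser of `a` and `O(a / g a)` meets `O(f a / a)`, then
`f ∈ S * g * S * g⁻¹ * S`. The hypothesis on the basis provides an open set of such `f` for a
fixed `g ∈ V`, which is therefore contained in `V ^ (3 * 6 + 2) = V ^ 20`; those `f` lie near the
identity, so dividing by one of them in `V` makes `V ^ 21` a neighbourhood of the identity
(`interior_pow_nonempty`). For symmetric `W` the latter is contained in `W ^ 42`.
Automatic continuity is a formal consequence of the Steinhaus property.
-/

namespace MetricStr

open Filter TopologicalSpace

/-! ### Category arguments in topological groups -/

section Category

/-- A meagre subset of a Baire group can be avoided, up to meagre error, by a left translate of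
any separable family: it suffices to move a countable dense part of the family off the closed
nowhere dense pieces. -/
theorem exists_isMeagre_preimage_mul {G Y : Type*} [Group G] [TopologicalSpace G]
    [IsTopologicalGroup G] [BaireSpace G] [TopologicalSpace Y] [SeparableSpace Y]
    {f : Y → G} (hf : Continuous f) {M : Set G} (hM : IsMeagre M) :
    ∃ g : G, IsMeagre {y | g * f y ∈ M} := by
  obtain ⟨S, hS, hSc, hMS⟩ := isMeagre_iff_countable_union_isNowhereDense.1 hM
  obtain ⟨Q, hQc, hQd⟩ := exists_countable_dense Y
  have key : ∀ᶠ g in residual G, ∀ t ∈ S, ∀ q ∈ Q, g * f q ∉ closure t := by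
    rw [eventually_countable_ball hSc]
    intro t ht
    rw [eventually_countable_ball hQc]
    intro q _
    have h1 : IsOpen (closure t)ᶜ ∧ Dense (closure t)ᶜ :=
      isClosed_isNowhereDense_iff_compl.1 ⟨isClosed_closure, (hS t ht).closure⟩
    refine residual_of_dense_open (s := (Homeomorph.mulRight (f q)) ⁻¹' (closure t)ᶜ)
      (h1.1.preimage (Homeomorph.continuous _)) ?_
    exact h1.2.preimage (Homeomorph.isOpenMap _)
  obtain ⟨g, hg⟩ := (dense_of_mem_residual key).nonempty
  refine ⟨g, ?_⟩
  have hsub : {y | g * f y ∈ M} ⊆ ⋃ t ∈ S, {y | g * f y ∈ closure t} := by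
    intro y hy
    obtain ⟨t, ht, hyt⟩ := hMS hy
    simp only [mem_iUnion]
    exact ⟨t, ht, subset_closure hyt⟩
  refine IsMeagre.mono hsub (isMeagre_biUnion hSc fun t ht => ?_)
  have hcl : IsClosed {y | g * f y ∈ closure t} :=
    isClosed_closure.preimage (continuous_const.mul hf)
  refine IsNowhereDense.isMeagre (hcl.isNowhereDense_iff.2 ?_)
  by_contra hne
  obtain ⟨q, hq, hqQ⟩ := hQd.inter_open_nonempty _ isOpen_interior (nonempty_iff_ne_empty.2 hne)
  have hq' : q ∈ {y | g * f y ∈ closure t} := interior_subset hq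
  exact hg t ht q hqQ hq'

/-- Pettis' lemma: `S⁻¹ * S` is a neighbourhood of the identity if `S` is comeagre in some non-empty
open set. -/
theorem inv_mul_mem_nhds_one {G : Type*} [Group G] [TopologicalSpace G] [IsTopologicalGroup G]
    [BaireSpace G] {O S : Set G} (hO : IsOpen O) (hne : O.Nonempty) (hm : IsMeagre (O \ S)) :
    S⁻¹ * S ∈ 𝓝 (1 : G) := by
  obtain ⟨o, ho⟩ := hne
  have h1 : ∀ᶠ u in 𝓝 (1 : G), o * u ∈ O := by
    have : Tendsto (fun u => o * u) (𝓝 (1 : G)) (𝓝 (o * 1)) :=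
      (continuous_const.mul continuous_id).tendsto 1
    rw [mul_one] at this
    exact this (hO.mem_nhds ho)
  filter_upwards [h1] with u hu
  have hO' : IsOpen (O ∩ {y | y * u ∈ O}) :=
    hO.inter (hO.preimage (continuous_id.mul continuous_const))
  have hm' : IsMeagre {y | y * u ∈ O \ S} :=
    hm.preimage_of_isOpenMap (Homeomorph.mulRight u).continuous (Homeomorph.mulRight u).isOpenMap
  have hnm := not_isMeagre_of_isOpen hO' ⟨o, ho, hu⟩
  obtain ⟨y, hy, hy'⟩ : ∃ y ∈ O ∩ {y | y * u ∈ O}, y ∉ (O \ S) ∪ {y | y * u ∈ O \ S} := by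
    by_contra! h
    exact hnm ((hm.union hm').mono h)
  have hyS : y ∈ S := by
    by_contra h
    exact hy' (Or.inl ⟨hy.1, h⟩)
  have hyuS : y * u ∈ S := by
    by_contra h
    exact hy' (Or.inr ⟨hy.2, h⟩)
  exact ⟨y⁻¹, Set.inv_mem_inv.2 hyS, y * u, hyuS, by simp⟩

/-- If `W` is somewhere dense then `W⁻¹ * W` is dense in a neighbourhood of the identity. -/
theorem closure_inv_mul_mem_nhds_one {G : Type*} [Group G] [TopologicalSpace G]
    [IsTopologicalGroup G] {W : Set G} (hW : ¬ IsNowhereDense W) :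
    closure (W⁻¹ * W) ∈ 𝓝 (1 : G) := by
  obtain ⟨o, ho⟩ := nonempty_iff_ne_empty.2 hW
  have h1 : ∀ᶠ u in 𝓝 (1 : G), o * u ∈ closure W := by
    have : Tendsto (fun u => o * u) (𝓝 (1 : G)) (𝓝 (o * 1)) :=
      (continuous_const.mul continuous_id).tendsto 1
    rw [mul_one] at this
    exact this (mem_interior_iff_mem_nhds.1 ho)
  filter_upwards [h1] with u hu
  have : o⁻¹ * (o * u) ∈ closure (W⁻¹ * W) :=
    map_mem_closure₂ (f := fun a b : G => a⁻¹ * b) (by fun_prop) (interior_subset ho) hu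
      (fun a ha b hb => Set.mul_mem_mul (Set.inv_mem_inv.2 ha) hb)
  simpa using this

end Category

/-! ### Groups with ample generic elements -/

section AmpleGenerics

variable {H : Type*} [Group H]

/-- An abstract form of ample generics: a notion of rich tuple, inherited by generic one-point
extensions, and such that the one-point extensions of a rich tuple `T` that are rich and close to
each other are conjugate by an element close to the identity that centralises `T`. -/
structure AmpleGenerics [TopologicalSpace H] (Rich : ∀ n, (Fin n → H) → Prop) : Prop where
  nil : ∀ T : Fin 0 → H, Rich 0 T
  generic : ∀ n (T : Fin n → H), Rich n T →
    ∀ᶠ a in residual H, Rich (n + 1) (Fin.cons a T)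
  conj : ∀ n (T : Fin n → H) (a : H), Rich (n + 1) (Fin.cons a T) → ∀ V ∈ 𝓝 (1 : H),
    ∃ U ∈ 𝓝 a, ∀ b ∈ U, Rich (n + 1) (Fin.cons b T) →
      ∃ v ∈ V, (∀ i, v * T i * v⁻¹ = T i) ∧ v * b * v⁻¹ = a

variable [TopologicalSpace H]

/-- One splitting of the Cantor scheme: a rich tuple is extended in two ways, by an element of `A`
and by an element of `B` conjugate to it over the tuple. -/
theorem AmpleGenerics.exists_split {Rich : ∀ n, (Fin n → H) → Prop}
    (hR : AmpleGenerics Rich) {n : ℕ} {T : Fin n → H} (hT : Rich n T) {A B V : Set H}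
    (hA : ¬ IsMeagre A) (hB : ∀ O : Set H, IsOpen O → O.Nonempty → ¬ IsMeagre (O ∩ B))
    (hV : V ∈ 𝓝 (1 : H)) :
    ∃ a ∈ A, ∃ b ∈ B, ∃ v ∈ V, Rich (n + 1) (Fin.cons a T) ∧ Rich (n + 1) (Fin.cons b T) ∧
      (∀ i, v * T i * v⁻¹ = T i) ∧ v * b * v⁻¹ = a := by
  have hgen := hR.generic n T hT
  have pick : ∀ S : Set H, ¬ IsMeagre S → ∃ a ∈ S, Rich (n + 1) (Fin.cons a T) := by
    intro S hS
    by_contra! h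
    refine hS ?_
    rw [IsMeagre]
    filter_upwards [hgen] with a ha haS
    exact h a haS ha
  obtain ⟨a, haA, haR⟩ := pick A hA
  obtain ⟨U, hU, hconj⟩ := hR.conj n T a haR V hV
  obtain ⟨b, hbUB, hbR⟩ := pick (interior U ∩ B)
    (hB _ isOpen_interior ⟨a, mem_interior_iff_mem_nhds.2 hU⟩)
  obtain ⟨v, hv, hvT, hvb⟩ := hconj b (interior_subset hbUB.1) hbR
  exact ⟨a, haA, b, hbUB.2, v, hv, haR, hbR, hvT, hvb⟩

/-- The Cantor scheme: given non-meagre sets `A n` and sets `B n` non-meagre in every non-empty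
open set, there is a continuous family `h x`, indexed by the Cantor space, such that whenever
`x` and `y` first differ at `m`, a conjugate of an element of `A m` by `h x` is a conjugate
of an element of `B m` by `h y`. -/
theorem AmpleGenerics.exists_cantor_scheme [IsTopologicalGroup H] [IsCompletelyMetrizableSpace H]
    {Rich : ∀ n, (Fin n → H) → Prop} (hR : AmpleGenerics Rich) {A B : ℕ → Set H}
    (hA : ∀ n, ¬ IsMeagre (A n))
    (hB : ∀ n, ∀ O : Set H, IsOpen O → O.Nonempty → ¬ IsMeagre (O ∩ B n)) :
    ∃ h : (ℕ → Bool) → H, Continuous h ∧ ∀ (x y : ℕ → Bool) (m : ℕ), (∀ i < m, x i = y i) →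
      x m = false → y m = true →
      ∃ a ∈ A m, ∃ b ∈ B m, h x * a * (h x)⁻¹ = h y * b * (h y)⁻¹ := by
  let _ := TopologicalSpace.upgradeIsCompletelyMetrizable H
  -- a state at level `n` is a rich `n`-tuple together with the conjugating element found so far
  have hstep : ∀ (n : ℕ) (s : {T : Fin n → H // Rich n T} × H),
      ∃ a ∈ A n, ∃ b ∈ B n, ∃ v ∈ {v : H | dist s.2 (s.2 * v) < 1 / 2 / 2 ^ n},
        Rich (n + 1) (Fin.cons a s.1.1) ∧ Rich (n + 1) (Fin.cons b s.1.1) ∧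
        (∀ i, v * s.1.1 i * v⁻¹ = s.1.1 i) ∧ v * b * v⁻¹ = a := by
    intro n s
    refine hR.exists_split s.1.2 (hA n) (hB n) ?_
    have hc : Continuous fun v : H => dist s.2 (s.2 * v) := by fun_prop
    refine (isOpen_lt hc continuous_const).mem_nhds ?_
    simp only [mem_ofPred_eq, mul_one, dist_self]
    positivity
  choose a haA b hbB v hv haR hbR hvT hvb using hstep
  let next : ∀ n, {T : Fin n → H // Rich n T} × H → Bool →
      {T : Fin (n + 1) → H // Rich (n + 1) T} × H := fun n s bit =>
    if bit then (⟨Fin.cons (b n s) s.1.1, hbR n s⟩, s.2 * v n s)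
    else (⟨Fin.cons (a n s) s.1.1, haR n s⟩, s.2)
  let st : (ℕ → Bool) → ∀ n, {T : Fin n → H // Rich n T} × H := fun x n =>
    Nat.rec (motive := fun n => {T : Fin n → H // Rich n T} × H)
      (⟨Fin.elim0, hR.nil _⟩, 1) (fun n s => next n s (x n)) n
  have st_succ : ∀ x n, st x (n + 1) = next n (st x n) (x n) := fun x n => rfl
  have st_congr : ∀ x y n, (∀ i < n, x i = y i) → st x n = st y n := by
    intro x y n
    induction n with
    | zero => intro _; rfl
    | succ k ih =>
      intro hxy
      rw [st_succ, st_succ, ih fun i hi => hxy i (by omega), hxy k (by omega)]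
  have st_dist : ∀ x n, dist (st x n).2 (st x (n + 1)).2 ≤ 1 / 2 / 2 ^ n := by
    intro x n
    rw [st_succ]
    cases x n
    · simp only [next, Bool.false_eq_true, if_false, dist_self]; positivity
    · exact (hv n (st x n)).le
  have hlim : ∀ x, ∃ g, Tendsto (fun n => (st x n).2) atTop (𝓝 g) := fun x =>
    cauchySeq_tendsto_of_complete (cauchySeq_of_le_geometric_two (st_dist x))
  choose h hh using hlim
  have hdist : ∀ x n, dist (st x n).2 (h x) ≤ 1 / 2 ^ n := fun x n =>
    dist_le_of_le_geometric_two_of_tendsto (st_dist x) (hh x) n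
  have st_mono : ∀ x n k t, t ∈ range (st x n).1.1 →
      t ∈ range (st x (n + k)).1.1 ∧
      (st x (n + k)).2 * t * (st x (n + k)).2⁻¹ = (st x n).2 * t * (st x n).2⁻¹ := by
    intro x n k t ht
    induction k with
    | zero => exact ⟨ht, rfl⟩
    | succ k ih =>
      obtain ⟨⟨i, hi⟩, hc⟩ := ih
      rw [← add_assoc, st_succ, ← hc]
      cases x (n + k)
      · simp only [next, Bool.false_eq_true, if_false, and_true]
        exact ⟨i.succ, by simp [hi]⟩
      · simp only [next, if_true]
        refine ⟨⟨i.succ, by simp [hi]⟩, ?_⟩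
        have := hvT (n + k) (st x (n + k)) i
        rw [hi] at this
        conv_rhs => rw [← this]
        group
  have hconj : ∀ x n t, t ∈ range (st x n).1.1 →
      h x * t * (h x)⁻¹ = (st x n).2 * t * (st x n).2⁻¹ := by
    intro x n t ht
    have h1 : Tendsto (fun k => (st x (n + k)).2 * t * (st x (n + k)).2⁻¹) atTop
        (𝓝 (h x * t * (h x)⁻¹)) := by
      have h2 : Tendsto (fun k => (st x (n + k)).2) atTop (𝓝 (h x)) :=
        (hh x).comp (tendsto_atTop_mono (fun k => Nat.le_add_left k n) tendsto_id)
      exact (h2.mul_const t).mul h2.inv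
    refine tendsto_nhds_unique h1 ?_
    simp only [fun k => (st_mono x n k t ht).2]
    exact tendsto_const_nhds
  refine ⟨h, ?_, ?_⟩
  · rw [continuous_iff_continuousAt]
    intro x
    rw [ContinuousAt, Metric.tendsto_nhds]
    intro ε hε
    obtain ⟨n, hn⟩ := exists_pow_lt_of_lt_one (show (0 : ℝ) < ε / 2 by positivity)
      (show (1 / 2 : ℝ) < 1 by norm_num)
    have hnb : {y : ℕ → Bool | ∀ i < n, y i = x i} ∈ 𝓝 x := by
      have : ∀ᶠ y : ℕ → Bool in 𝓝 x, ∀ i ∈ Finset.range n, y i = x i := by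
        rw [Filter.eventually_all_finset]
        intro i _
        exact ((isOpen_discrete {x i}).preimage
          (continuous_apply (A := fun _ : ℕ => Bool) i)).mem_nhds rfl
      filter_upwards [this] with y hy i hi using hy i (Finset.mem_range.2 hi)
    filter_upwards [hnb] with y hy
    have h1 := hdist x n
    have h2 := hdist y n
    rw [st_congr y x n hy, dist_comm] at h2
    have : (1 : ℝ) / 2 ^ n = (1 / 2) ^ n := by simp
    calc dist (h y) (h x) ≤ dist (h y) (st x n).2 + dist (st x n).2 (h x) := dist_triangle _ _ _
      _ < ε := by linarith
  · intro x y m hxy hx hy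
    refine ⟨a m (st x m), haA _ _, b m (st x m), hbB _ _, ?_⟩
    have e1 : st x (m + 1) = next m (st x m) false := by rw [st_succ, hx]
    have e2 : st y (m + 1) = next m (st x m) true := by
      rw [st_succ, hy, st_congr y x m fun i hi => (hxy i hi).symm]
    rw [hconj x (m + 1) _ (by rw [e1]; exact ⟨0, by simp [next]⟩),
      hconj y (m + 1) _ (by rw [e2]; exact ⟨0, by simp [next]⟩), e1, e2]
    simp only [next, Bool.false_eq_true, if_false, if_true]
    conv_lhs => rw [← hvb m (st x m)]
    group

/-- In a group with ample generics, every countable cover has a non-meagre member `C n` such that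
`((C n)⁻¹ * C n) ^ 6` is a neighbourhood of the identity. Otherwise the Cantor scheme applies to
`V = (C n)⁻¹ * C n` and the complement of `V ^ 3`; two points of its image in a common translate
of `C n` conjugate an element of `V` to one outside `V ^ 3` by an element of `V`. -/
theorem AmpleGenerics.exists_pow_mem_nhds_one [IsTopologicalGroup H] [IsCompletelyMetrizableSpace H]
    {Rich : ∀ n, (Fin n → H) → Prop} (hR : AmpleGenerics Rich) {C : ℕ → Set H}
    (hC : ⋃ n, C n = univ) :
    ∃ n, ¬ IsMeagre (C n) ∧ ((C n)⁻¹ * C n) ^ 6 ∈ 𝓝 (1 : H) := by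
  classical
  by_contra! hcon
  set V : ℕ → Set H := fun n => (C n)⁻¹ * C n with hVdef
  have hVinv : ∀ n, (V n)⁻¹ = V n := fun n => by simp [hVdef, mul_inv_rev]
  -- every `n` is treated at infinitely many levels `m`, namely those with `m.unpair.1 = n`
  let A : ℕ → Set H := fun m => if IsMeagre (C m.unpair.1) then univ else V m.unpair.1
  let B : ℕ → Set H := fun m => if IsMeagre (C m.unpair.1) then univ else (V m.unpair.1 ^ 3)ᶜ
  have hA : ∀ m, ¬ IsMeagre (A m) := by
    intro m
    by_cases hm : IsMeagre (C m.unpair.1)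
    · simp only [A, hm, if_true]
      exact not_isMeagre_of_isOpen isOpen_univ ⟨1, mem_univ _⟩
    · simp only [A, hm, if_false]
      intro hmea
      obtain ⟨c, hc⟩ := nonempty_of_not_isMeagre hm
      refine hm (IsMeagre.mono ?_ (hmea.preimage_of_isOpenMap
        (Homeomorph.mulLeft c⁻¹).continuous (Homeomorph.mulLeft c⁻¹).isOpenMap))
      intro y hy
      exact Set.mul_mem_mul (Set.inv_mem_inv.2 hc) hy
  have hB : ∀ m, ∀ O : Set H, IsOpen O → O.Nonempty → ¬ IsMeagre (O ∩ B m) := by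
    intro m O hO hne hmea
    by_cases hm : IsMeagre (C m.unpair.1)
    · simp only [B, hm, if_true, inter_univ] at hmea
      exact not_isMeagre_of_isOpen hO hne hmea
    · simp only [B, hm, if_false] at hmea
      refine hcon _ hm ?_
      have := inv_mul_mem_nhds_one hO hne hmea
      rwa [← inv_pow, hVinv, ← pow_add] at this
  obtain ⟨h, hcont, hsplit⟩ := hR.exists_cantor_scheme hA hB
  -- a translate of the image of the Cantor space avoids the meagre members of the cover
  obtain ⟨g, hg⟩ := exists_isMeagre_preimage_mul hcont
    (M := ⋃ n ∈ {n | IsMeagre (C n)}, C n)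
    (isMeagre_biUnion (Set.to_countable _) fun n hn => hn)
  let S : ℕ → Set (ℕ → Bool) := fun n => {x | g * h x ∈ C n}
  -- some `S n` with `C n` non-meagre is dense in a non-empty open set
  obtain ⟨n, hnm, hSn⟩ : ∃ n, ¬ IsMeagre (C n) ∧ ¬ IsNowhereDense (S n) := by
    by_contra! hall
    refine not_isMeagre_of_isOpen (X := ℕ → Bool) isOpen_univ ⟨fun _ => false, mem_univ _⟩ ?_
    refine IsMeagre.mono (s := _ ∪ ⋃ n ∈ {n | ¬ IsMeagre (C n)}, S n) ?_
      (hg.union (isMeagre_biUnion (Set.to_countable _) fun n hn => (hall n hn).isMeagre))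
    intro x _
    obtain ⟨n, hn⟩ := mem_iUnion.1 (hC.ge (mem_univ (g * h x)))
    by_cases hm : IsMeagre (C n)
    · exact Or.inl (mem_biUnion (show n ∈ {n | IsMeagre (C n)} from hm) hn)
    · exact Or.inr (mem_biUnion (show n ∈ {n | ¬ IsMeagre (C n)} from hm) hn)
  obtain ⟨x₀, hx₀⟩ := nonempty_iff_ne_empty.2 hSn
  obtain ⟨N, hN⟩ : ∃ N, ∀ y : ℕ → Bool, (∀ i < N, y i = x₀ i) → y ∈ closure (S n) := by
    have hnb := mem_interior_iff_mem_nhds.1 hx₀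
    rw [nhds_pi, Filter.mem_pi] at hnb
    obtain ⟨I, hI, t, ht, hsub⟩ := hnb
    obtain ⟨N, hN⟩ := hI.bddAbove
    refine ⟨N + 1, fun y hy => hsub fun i hi => ?_⟩
    rw [hy i (Nat.lt_succ_of_le (hN hi))]
    exact mem_of_mem_nhds (ht i)
  -- a splitting level beyond `N` devoted to `n`
  set m := Nat.pair n N with hm
  have hmN : N ≤ m := Nat.right_le_pair n N
  have hpick : ∀ bit : Bool, ∃ x ∈ S n, (∀ i < m, x i = x₀ i) ∧ x m = bit := by
    intro bit
    have hop : IsOpen ((⋂ i ∈ Finset.range m, (fun y : ℕ → Bool => y i) ⁻¹' {x₀ i}) ∩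
        (fun y : ℕ → Bool => y m) ⁻¹' {bit}) :=
      (isOpen_biInter_finset fun i _ =>
        (isOpen_discrete {x₀ i}).preimage (continuous_apply (A := fun _ : ℕ => Bool) i)).inter
        ((isOpen_discrete {bit}).preimage (continuous_apply (A := fun _ : ℕ => Bool) m))
    have hmem : Function.update x₀ m bit ∈ closure (S n) := by
      refine hN _ fun i hi => ?_
      rw [Function.update_of_ne (by omega)]
    obtain ⟨x, hx, hxS⟩ := mem_closure_iff.1 hmem _ hop (by
      refine ⟨mem_iInter₂.2 fun i hi => ?_, by simp⟩
      have hi := Finset.mem_range.1 hi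
      simp [Function.update_of_ne hi.ne])
    exact ⟨x, hxS, fun i hi => mem_iInter₂.1 hx.1 i (Finset.mem_range.2 hi), hx.2⟩
  obtain ⟨x, hxS, hx, hxm⟩ := hpick false
  obtain ⟨y, hyS, hy, hym⟩ := hpick true
  obtain ⟨p, hp, q, hq, hpq⟩ := hsplit x y m (fun i hi => by rw [hx i hi, hy i hi]) hxm hym
  have hunp : m.unpair.1 = n := by simp [hm]
  simp only [A, B, hunp, hnm, if_false] at hp hq
  refine hq ?_
  have e : q = ((g * h y)⁻¹ * (g * h x)) * p * ((g * h x)⁻¹ * (g * h y)) := by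
    have : q = (h y)⁻¹ * (h y * q * (h y)⁻¹) * h y := by group
    rw [this, ← hpq]
    group
  rw [e, pow_succ, pow_two]
  exact Set.mul_mem_mul (Set.mul_mem_mul (Set.mul_mem_mul (Set.inv_mem_inv.2 hyS) hxS) hp)
    (Set.mul_mem_mul (Set.inv_mem_inv.2 hxS) hyS)

end AmpleGenerics

/-! ### The automorphism group of a metric structure -/

section AutTopology

variable {L : FirstOrder.Language.{u, v}} {X : Type w} [L.Structure X]

@[simp] theorem Aut.inv_apply_apply (g : Aut L X) (x : X) : g⁻¹ (g x) = x := g.symm_apply_apply x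

@[simp] theorem Aut.apply_inv_apply (g : Aut L X) (x : X) : g (g⁻¹ x) = x := g.apply_symm_apply x

variable [MetricSpace X] {ι : MetricStr.Ldist →ᴸ L}

theorem IsMetricStructure.isometry (hX : IsMetricStructure ι X) (g : Aut L X) : Isometry g := by
  have key : ∀ (r : ℚ≥0) (x y : X), dist (g x) (g y) ≤ (r : ℝ) ↔ dist x y ≤ (r : ℝ) := by
    intro r x y
    have : (g ∘ ![x, y] : Fin 2 → X) = ![g x, g y] := by
      funext i; fin_cases i <;> rfl
    rw [← hX.relMap_dist_iff r x y, ← g.map_rel, this]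
    exact (hX.relMap_dist_iff r (g x) (g y)).symm
  have key' : ∀ (a b : ℝ), 0 ≤ a → (∀ r : ℚ≥0, a ≤ (r : ℝ) → b ≤ (r : ℝ)) → b ≤ a := by
    intro a b ha h
    by_contra! hab
    obtain ⟨q, hq1, hq2⟩ := exists_rat_btwn hab
    have hq0 : 0 ≤ q := by exact_mod_cast (ha.trans hq1.le)
    have := h ⟨q, hq0⟩ hq1.le
    exact absurd this (not_le.2 hq2)
  refine Isometry.of_dist_eq fun x y => le_antisymm ?_ ?_
  · exact key' _ _ dist_nonneg fun r => (key r x y).2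
  · exact key' _ _ dist_nonneg fun r => (key r x y).1

theorem Aut.continuous_eval (x : X) : Continuous fun g : Aut L X => g x :=
  (continuous_apply x).comp continuous_induced_dom

theorem Aut.tendsto_nhds_iff {α : Type*} {l : Filter α} {f : α → Aut L X} {g : Aut L X} :
    Tendsto f l (𝓝 g) ↔ ∀ x, Tendsto (fun a => f a x) l (𝓝 (g x)) := by
  rw [nhds_induced, tendsto_comap_iff, tendsto_pi_nhds]
  rfl

theorem IsMetricStructure.isTopologicalGroup (hX : IsMetricStructure ι X) :
    IsTopologicalGroup (Aut L X) where
  continuous_mul := by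
    rw [continuous_iff_continuousAt]
    rintro ⟨g, h⟩
    refine Aut.tendsto_nhds_iff.2 fun x => ?_
    have h1 : Tendsto (fun p : Aut L X × Aut L X => dist (p.2 x) (h x) + dist (p.1 (h x)) (g (h x)))
        (𝓝 (g, h)) (𝓝 0) := by
      have a1 : Continuous fun p : Aut L X × Aut L X => p.2 x :=
        (Aut.continuous_eval x).comp continuous_snd
      have a2 : Continuous fun p : Aut L X × Aut L X => p.1 (h x) :=
        (Aut.continuous_eval (h x)).comp continuous_fst
      have : Continuous fun p : Aut L X × Aut L X =>
          dist (p.2 x) (h x) + dist (p.1 (h x)) (g (h x)) := by fun_prop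
      simpa using this.tendsto (g, h)
    rw [tendsto_iff_dist_tendsto_zero]
    refine squeeze_zero (fun _ => dist_nonneg) (fun p => ?_) h1
    calc dist (p.1 (p.2 x)) (g (h x)) ≤ dist (p.1 (p.2 x)) (p.1 (h x)) + dist (p.1 (h x)) (g (h x)) :=
          dist_triangle _ _ _
      _ = _ := by rw [(hX.isometry p.1).dist_eq]
  continuous_inv := by
    rw [continuous_iff_continuousAt]
    intro g
    refine Aut.tendsto_nhds_iff.2 fun x => ?_
    rw [tendsto_iff_dist_tendsto_zero]
    have h1 : Tendsto (fun k : Aut L X => dist (k (g⁻¹ x)) x) (𝓝 g) (𝓝 0) := by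
      have : Continuous fun k : Aut L X => dist (k (g⁻¹ x)) x :=
        (Aut.continuous_eval (g⁻¹ x)).dist continuous_const
      simpa using this.tendsto g
    refine h1.congr fun k => ?_
    rw [← (hX.isometry k).dist_eq (k⁻¹ x), Aut.apply_inv_apply, dist_comm]

theorem exists_tendsto_eval [CompleteSpace X] {D : Set X} (hD : Dense D) {α : Type*} {l : Filter α}
    [NeBot l] {f : α → X → X} (hf : ∀ a, Isometry (f a))
    (h : ∀ x ∈ D, ∃ y, Tendsto (fun a => f a x) l (𝓝 y)) (x : X) :
    ∃ y, Tendsto (fun a => f a x) l (𝓝 y) := by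
  refine cauchy_map_iff_exists_tendsto.1 (Metric.cauchy_iff.2 ⟨inferInstance, fun ε hε => ?_⟩)
  obtain ⟨d, hdD, hd⟩ := Metric.dense_iff.1 hD x (ε / 4) (by positivity)
  rw [Metric.mem_ball] at hdD
  obtain ⟨y, hy⟩ := h d hd
  refine ⟨_, image_mem_map (Metric.tendsto_nhds.1 hy (ε / 4) (by positivity)), ?_⟩
  rintro _ ⟨a, ha, rfl⟩ _ ⟨b, hb, rfl⟩
  have ha : dist (f a d) y < ε / 4 := ha
  have hb : dist (f b d) y < ε / 4 := hb
  have e1 := dist_triangle4 (f a x) (f a d) (f b d) (f b x)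
  have e2 := dist_triangle_right (f a d) (f b d) y
  rw [(hf a).dist_eq, (hf b).dist_eq, dist_comm x d] at e1
  linarith

/-- Completeness of the automorphism group: if `k x` and `k⁻¹ x` converge along a filter for all
`x` in a dense set, then `k` and `k⁻¹` converge pointwise to an automorphism and its inverse. -/
theorem IsMetricStructure.exists_tendsto [CompleteSpace X] (hX : IsMetricStructure ι X)
    {D : Set X} (hD : Dense D) {l : Filter (Aut L X)} [NeBot l]
    (h : ∀ x ∈ D, ∃ y, Tendsto (fun k : Aut L X => k x) l (𝓝 y))
    (h' : ∀ x ∈ D, ∃ y, Tendsto (fun k : Aut L X => k⁻¹ x) l (𝓝 y)) :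
    ∃ g : Aut L X, ∀ x, Tendsto (fun k : Aut L X => k x) l (𝓝 (g x)) ∧
      Tendsto (fun k : Aut L X => k⁻¹ x) l (𝓝 (g⁻¹ x)) := by
  choose U hU using exists_tendsto_eval hD (fun k : Aut L X => hX.isometry k) h
  choose V hV using exists_tendsto_eval hD (fun k : Aut L X => hX.isometry k⁻¹) h'
  have inv_aux : ∀ (P Q : X → X) (f g : Aut L X → Aut L X), (∀ k x, g k (f k x) = x) →
      (∀ x, Tendsto (fun k => f k x) l (𝓝 (P x))) → (∀ x, Tendsto (fun k => g k x) l (𝓝 (Q x))) →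
      ∀ x, Q (P x) = x := by
    intro P Q f g hfg hP hQ x
    refine tendsto_nhds_unique (hQ (P x)) ?_
    rw [tendsto_iff_dist_tendsto_zero]
    refine ((tendsto_iff_dist_tendsto_zero.1 (hP x))).congr fun k => ?_
    rw [← (hX.isometry (g k)).dist_eq, hfg, dist_comm]
  have hVU := inv_aux U V (fun k => k) (fun k => k⁻¹) (fun k x => Aut.inv_apply_apply k x) hU hV
  have hUV := inv_aux V U (fun k => k⁻¹) (fun k => k) (fun k x => Aut.apply_inv_apply k x) hV hU
  have rel_aux : ∀ (P : X → X) (f : Aut L X → Aut L X),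
      (∀ x, Tendsto (fun k => f k x) l (𝓝 (P x))) → ∀ {n} (r : L.Relations n) (x : Fin n → X),
      FirstOrder.Language.Structure.RelMap r x →
      FirstOrder.Language.Structure.RelMap r (P ∘ x) := by
    intro P f hP n r x hx
    have ht : Tendsto (fun k => (f k) ∘ x) l (𝓝 (P ∘ x)) :=
      tendsto_pi_nhds.2 fun i => hP (x i)
    exact (hX.isClosed_relMap n r).mem_of_tendsto ht
      (Eventually.of_forall fun k => ((f k).map_rel r x).2 hx)
  refine ⟨⟨⟨U, V, hVU, hUV⟩, ?_, ?_⟩, fun x => ⟨hU x, hV x⟩⟩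
  · intro n f x
    have ht : Tendsto (fun k : Aut L X => k ∘ x) l (𝓝 (U ∘ x)) :=
      tendsto_pi_nhds.2 fun i => hU (x i)
    refine tendsto_nhds_unique (hU _) ?_
    refine (((hX.continuous_funMap n f).tendsto _).comp ht).congr fun k => ?_
    exact (k.map_fun f x).symm
  · intro n r x
    refine ⟨fun hx => ?_, fun hx => rel_aux U (fun k => k) hU r x hx⟩
    have := rel_aux V (fun k => k⁻¹) hV r _ hx
    have e : V ∘ (U ∘ x) = x := funext fun i => hVU (x i)
    exact e ▸ this

theorem IsMetricStructure.eq_of_eqOn_dense (hX : IsMetricStructure ι X) {D : Set X} (hD : Dense D)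
    {g h : Aut L X} (hgh : EqOn g h D) : g = h :=
  FirstOrder.Language.Equiv.ext fun x => congrFun
    (Continuous.ext_on hD (hX.isometry g).continuous (hX.isometry h).continuous hgh) x

/-- The automorphism group of a separable complete metric structure is Polish, as an automorphism
is determined by its values and the values of its inverse on a countable dense set. -/
theorem IsMetricStructure.polishSpace [CompleteSpace X] [SeparableSpace X]
    (hX : IsMetricStructure ι X) : PolishSpace (Aut L X) := by
  obtain ⟨D, hDc, hD⟩ := exists_countable_dense X
  have := hDc.to_subtype
  have := hX.isTopologicalGroup
  let e : Aut L X → (D → X) × (D → X) := fun g => (fun x => g x, fun x => g⁻¹ x)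
  have he : Continuous e :=
    (continuous_pi fun x : D => Aut.continuous_eval (x : X)).prodMk
      (continuous_pi fun x : D => (Aut.continuous_eval (L := L) (x : X)).comp continuous_inv)
  have lim : ∀ p : (D → X) × (D → X), NeBot (comap e (𝓝 p)) →
      ∃ g : Aut L X, e g = p ∧ comap e (𝓝 p) ≤ 𝓝 g := by
    intro p hp
    have h1 : ∀ x : D, Tendsto (fun k : Aut L X => k x) (comap e (𝓝 p)) (𝓝 (p.1 x)) := fun x =>
      (((continuous_apply x).comp continuous_fst).tendsto p).comp tendsto_comap
    have h2 : ∀ x : D, Tendsto (fun k : Aut L X => k⁻¹ x) (comap e (𝓝 p)) (𝓝 (p.2 x)) := fun x =>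
      (((continuous_apply x).comp continuous_snd).tendsto p).comp tendsto_comap
    obtain ⟨g, hg⟩ := hX.exists_tendsto hD (l := comap e (𝓝 p))
      (fun x hx => ⟨_, h1 ⟨x, hx⟩⟩) (fun x hx => ⟨_, h2 ⟨x, hx⟩⟩)
    refine ⟨g, Prod.ext (funext fun x => ?_) (funext fun x => ?_),
      Aut.tendsto_nhds_iff.2 fun x => (hg x).1⟩
    · exact tendsto_nhds_unique (hg x).1 (h1 x)
    · exact tendsto_nhds_unique (hg x).2 (h2 x)
  have hinj : Function.Injective e := fun g h hgh =>
    hX.eq_of_eqOn_dense hD fun x hx => congrFun (congrArg Prod.fst hgh) ⟨x, hx⟩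
  have hemb : IsClosedEmbedding e := by
    refine ⟨⟨isInducing_iff_nhds.2 fun g => le_antisymm (he.tendsto g).le_comap ?_, hinj⟩,
      isClosed_of_closure_subset fun p hp => ?_⟩
    · have hne : NeBot (comap e (𝓝 (e g))) :=
        (inferInstance : NeBot (𝓝 g)).mono (he.tendsto g).le_comap
      obtain ⟨g', hg', hle⟩ := lim _ hne
      rwa [hinj hg'] at hle
    · obtain ⟨g, hg, _⟩ := lim p (comap_neBot_iff_frequently.2 (mem_closure_iff_frequently.1 hp))
      exact ⟨g, hg⟩
  have : PolishSpace X := inferInstance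
  exact hemb.polishSpace

end AutTopology

/-! ### Automorphisms and finitely generated substructures -/

section Substructures

open FirstOrder.Language.Substructure

variable {L : FirstOrder.Language.{u, v}} {X : Type w} [L.Structure X]

theorem Aut.eqOn_closure {g h : Aut L X} {F : Set X} (hF : EqOn g h F) :
    EqOn g h (closure L F) :=
  FirstOrder.Language.Hom.eqOn_closure (f := g.toHom) (g := h.toHom) hF

/-- The automorphism `g` maps the substructure `E` onto itself. -/
def Stabilises (g : Aut L X) (E : L.Substructure X) : Prop := ∀ x, g x ∈ E ↔ x ∈ E

theorem stabilises_iff_map_eq {g : Aut L X} {E : L.Substructure X} :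
    Stabilises g E ↔ E.map g.toHom = E := by
  constructor
  · intro h
    ext x
    rw [Language.Substructure.mem_map]
    constructor
    · rintro ⟨y, hy, rfl⟩
      exact (h y).2 hy
    · intro hx
      exact ⟨g⁻¹ x, (h _).1 (by simpa using hx), Aut.apply_inv_apply g x⟩
  · intro h x
    constructor
    · intro hx
      rw [← h, Language.Substructure.mem_map] at hx
      obtain ⟨y, hy, hyx⟩ := hx
      exact g.injective hyx ▸ hy
    · intro hx
      rw [← h, Language.Substructure.mem_map]
      exact ⟨x, hx, rfl⟩

theorem Stabilises.mul {g h : Aut L X} {E : L.Substructure X} (hg : Stabilises g E)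
    (hh : Stabilises h E) : Stabilises (g * h) E := fun x => (hg (h x)).trans (hh x)

theorem Stabilises.inv {g : Aut L X} {E : L.Substructure X} (hg : Stabilises g E) :
    Stabilises g⁻¹ E := fun x => by rw [← hg (g⁻¹ x), Aut.apply_inv_apply]

theorem Stabilises.congr {g h : Aut L X} {E : L.Substructure X} (hg : Stabilises g E)
    (hgh : EqOn g h E) : Stabilises h E := by
  intro x
  constructor
  · intro hx
    have h1 : g⁻¹ (h x) ∈ E := (hg.inv _).2 hx
    have h2 : h (g⁻¹ (h x)) = h x := by rw [← hgh h1, Aut.apply_inv_apply]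
    exact h.injective h2 ▸ h1
  · intro hx
    rw [← hgh hx]
    exact (hg x).2 hx

theorem stabilises_one (E : L.Substructure X) : Stabilises (1 : Aut L X) E := fun _ => Iff.rfl

theorem Stabilises.sup {g : Aut L X} {E E' : L.Substructure X} (h : Stabilises g E)
    (h' : Stabilises g E') : Stabilises g (E ⊔ E') := by
  rw [stabilises_iff_map_eq] at *
  rw [Language.Substructure.map_sup, h, h']

theorem map_closure_eq (g : Aut L X) (F : Set X) :
    (closure L F).map g.toHom = closure L (g '' F) := (closure_image g.toHom).symm

theorem apply_mem_closure_image (g : Aut L X) {F : Set X} {x : X} :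
    g x ∈ closure L (g '' F) ↔ x ∈ closure L F := by
  rw [← map_closure_eq, Language.Substructure.mem_map]
  exact ⟨fun ⟨y, hy, hyx⟩ => g.injective hyx ▸ hy, fun hx => ⟨x, hx, rfl⟩⟩

/-- If `g` intertwines `p` and `r` on generators, it carries `p`-invariance to `r`-invariance. -/
theorem Stabilises.image {p g r : Aut L X} {F : Set X} (hp : Stabilises p (closure L F))
    (h : ∀ x ∈ F, g (p x) = r (g x)) : Stabilises r (closure L (g '' F)) := by
  have h1 : Stabilises (g * p * g⁻¹) (closure L (g '' F)) := by
    intro x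
    rw [Aut.mul_apply, Aut.mul_apply, apply_mem_closure_image, hp, ← apply_mem_closure_image g,
      Aut.apply_inv_apply]
  refine h1.congr (Aut.eqOn_closure ?_)
  rintro _ ⟨x, hx, rfl⟩
  rw [Aut.mul_apply, Aut.mul_apply, Aut.inv_apply_apply, h x hx]

/-- The restriction of an automorphism to a substructure it stabilises. -/
def Stabilises.restrict {g : Aut L X} {E : L.Substructure X} (h : Stabilises g E) : E ≃[L] E where
  toEquiv := g.toEquiv.subtypeEquiv fun x => (h x).symm
  map_fun' f x := Subtype.ext (g.map_fun f (fun i => (x i : X)))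
  map_rel' r x := g.map_rel r (fun i => (x i : X))

@[simp] theorem Stabilises.coe_restrict {g : Aut L X} {E : L.Substructure X} (h : Stabilises g E)
    (x : E) : (h.restrict x : X) = g x := rfl

/-- The Hrushovski property for restrictions of automorphisms, in terms of generators. -/
theorem HrushovskiProperty.exists_stabilises (hhru : HrushovskiProperty L X) {n : ℕ}
    (c : Fin n → Aut L X) {F : Set X} (hF : F.Finite) :
    ∃ F₂ : Set X, F₂.Finite ∧ F ⊆ F₂ ∧ ∃ p : Fin n → Aut L X,
      ∀ i, EqOn (p i) (c i) F ∧ Stabilises (p i) (closure L F₂) := by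
  -- the identity is added to the family so that it is non-empty
  let c' : Fin (n + 1) → Aut L X := Fin.cons 1 c
  obtain ⟨E, ⟨S, hS⟩, hE, f, hf⟩ := hhru (n + 1) (fun _ => closure L F)
    (fun i => (closure L F).map (c' i).toHom) (fun _ => fg_closure hF)
    (fun i => (fg_closure hF).map _) (fun i => (c' i).toEmbedding.substructureEquivMap _)
  have hFE : closure L (F ∪ S) = E := by
    rw [Language.Substructure.closure_union, hS]
    exact sup_eq_right.2 (hE 0)
  refine ⟨F ∪ S, hF.union S.finite_toSet, subset_union_left, fun i => f i.succ, fun i => ⟨?_, ?_⟩⟩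
  · intro x hx
    have := (hf i.succ).1 ⟨x, subset_closure hx⟩
    exact this
  · rw [hFE]
    exact stabilises_iff_map_eq.2 (hf i.succ).2

/-- Simultaneous free amalgamation: after moving `F'` over `F` to a position independent from
`F₁`, automorphisms of the two generated substructures that agree on `F` extend to common
automorphisms. -/
theorem ExtensionProperty.exists_amalgam (hext : ExtensionProperty L X)
    (hhru : HrushovskiProperty L X) {n : ℕ} (c q : Fin n → Aut L X) {F F₁ F' : Set X}
    (hF₁ : F₁.Finite) (hF' : F'.Finite) (h₁ : F ⊆ F₁) (h' : F ⊆ F')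
    (hc : ∀ i, Stabilises (c i) (closure L F)) (hc₁ : ∀ i, Stabilises (c i) (closure L F₁))
    (hq : ∀ i, Stabilises (q i) (closure L F')) (hqc : ∀ i, EqOn (q i) (c i) F) :
    ∃ g : Aut L X, EqOn g id F ∧ ∃ r : Fin n → Aut L X,
      ∀ i, EqOn (r i) (c i) F₁ ∧ ∀ x ∈ F', r i (g x) = g (q i x) := by
  obtain ⟨g, hgF, hind⟩ := hext (closure L F) (closure L F₁) (closure L F')
    (fg_closure (hF₁.subset h₁)) (fg_closure hF₁) (fg_closure hF') (closure_mono h₁)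
    (closure_mono h')
  have hgA : EqOn g (1 : Aut L X) (closure L F) := hgF
  have hgS : Stabilises g (closure L F) := (stabilises_one _).congr fun x hx => (hgF x hx).symm
  have hqc' : ∀ i, EqOn (q i) (c i) (closure L F) := fun i => Aut.eqOn_closure (hqc i)
  have hqS : ∀ i, Stabilises (q i) (closure L F) := fun i => (hc i).congr (hqc' i).symm
  have hgq : ∀ i, Stabilises (g * q i * g⁻¹) ((closure L F').map g.toHom) := by
    intro i
    rw [map_closure_eq]
    exact (hq i).image fun x _ => by simp [Aut.mul_apply]
  have hσ : ∀ i, ∃ σ : (closure L F₁ ⊔ (closure L F').map g.toHom : L.Substructure X) ≃[L]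
      (closure L F₁ ⊔ (closure L F').map g.toHom : L.Substructure X),
      (∀ x ∈ closure L F₁, ∀ hx, (σ ⟨x, hx⟩ : X) = c i x) ∧
      (∀ x ∈ (closure L F').map g.toHom, ∀ hx, (σ ⟨x, hx⟩ : X) = (g * q i * g⁻¹) x) := by
    intro i
    obtain ⟨σ, h1, h2⟩ := hind (hc₁ i).restrict (hgq i).restrict (fun b => hc i b)
      (fun b => (hgS.mul (hqS i)).mul hgS.inv b) (by
        intro b d hbd hb
        have e1 : g⁻¹ (b : X) = b := by
          conv_lhs => rw [← hgF b hb]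
          exact Aut.inv_apply_apply g _
        rw [Stabilises.coe_restrict, Stabilises.coe_restrict, ← hbd, Aut.mul_apply, Aut.mul_apply,
          e1, hqc' i hb, hgF _ ((hc i b).2 hb)])
    exact ⟨σ, fun x hx hx' => h1 ⟨x, hx'⟩ ⟨x, hx⟩ rfl, fun x hx hx' => h2 ⟨x, hx'⟩ ⟨x, hx⟩ rfl⟩
  choose σ hσ₁ hσ₂ using hσ
  have hfg := (fg_closure (L := L) hF₁).sup ((fg_closure (L := L) hF').map g.toHom)
  obtain ⟨_, _, _, r, hr⟩ := hhru n _ _ (fun _ => hfg) (fun _ => hfg) σ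
  refine ⟨g, fun x hx => hgF x (subset_closure hx), r, fun i => ⟨fun x hx => ?_, fun x hx => ?_⟩⟩
  · have hx' := subset_closure (L := L) hx
    have hx'' : x ∈ (closure L F₁ ⊔ (closure L F').map g.toHom : L.Substructure X) :=
      le_sup_left (a := closure L F₁) hx'
    rw [← hσ₁ i x hx' hx'']
    exact (hr i).1 ⟨x, hx''⟩
  · have hx' : g x ∈ (closure L F').map g.toHom := ⟨x, subset_closure (L := L) hx, rfl⟩
    have hx'' : g x ∈ (closure L F₁ ⊔ (closure L F').map g.toHom : L.Substructure X) :=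
      le_sup_right (a := closure L F₁) hx'
    have h1 := hσ₂ i (g x) hx' hx''
    rw [Aut.mul_apply, Aut.mul_apply, Aut.inv_apply_apply] at h1
    rw [← h1]
    exact (hr i).1 ⟨g x, hx''⟩

end Substructures

/-! ### Countable approximations of the automorphism group -/

section Skolem

open FirstOrder.Language.Substructure

variable {L : FirstOrder.Language.{u, v}} {X : Type w} [L.Structure X]

/-- A countable dense set `D` with a countable group `Γ` of automorphisms that acts on it, closed
under witnesses for the Hrushovski property, for amalgamation, and for the failure of
inclusions of stabilisers of finite tuples in the sets `P k`. -/
structure SkolemSystem (L : FirstOrder.Language.{u, v}) (X : Type w) [L.Structure X]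
    [MetricSpace X] (P : ℕ → Set (Aut L X)) where
  /-- the points -/
  D : Set X
  /-- the group -/
  Γ : Subgroup (Aut L X)
  countable_D : D.Countable
  dense_D : Dense D
  countable_Γ : (Γ : Set (Aut L X)).Countable
  apply_mem : ∀ γ ∈ Γ, ∀ x ∈ D, γ x ∈ D
  hrushovski : ∀ (n : ℕ) (c : Fin n → Aut L X) (F : Set X), (∀ i, c i ∈ Γ) → F.Finite → F ⊆ D →
    ∃ F₂ : Set X, F₂.Finite ∧ F₂ ⊆ D ∧ F ⊆ F₂ ∧ ∃ p : Fin n → Aut L X, (∀ i, p i ∈ Γ) ∧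
      ∀ i, EqOn (p i) (c i) F ∧ Stabilises (p i) (closure L F₂)
  amalgam : ∀ (n : ℕ) (c q : Fin n → Aut L X) (F F₁ F' : Set X), (∀ i, c i ∈ Γ) →
    (∀ i, q i ∈ Γ) → F₁.Finite → F'.Finite → F₁ ⊆ D → F' ⊆ D → F ⊆ F₁ → F ⊆ F' →
    (∀ i, Stabilises (c i) (closure L F)) → (∀ i, Stabilises (c i) (closure L F₁)) →
    (∀ i, Stabilises (q i) (closure L F')) → (∀ i, EqOn (q i) (c i) F) →
    ∃ g ∈ Γ, EqOn g id F ∧ ∃ r : Fin n → Aut L X, (∀ i, r i ∈ Γ) ∧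
      ∀ i, EqOn (r i) (c i) F₁ ∧ ∀ x ∈ F', r i (g x) = g (q i x)
  reflect : ∀ (k : ℕ) (F : Set X), F.Finite → F ⊆ D → (∀ γ ∈ Γ, EqOn γ id F → γ ∈ P k) →
    ∀ g : Aut L X, EqOn g id F → g ∈ P k

/-- One step of the Löwenheim–Skolem construction: a countable pair `D`, `Γ` is enlarged to a
countable pair that contains witnesses for all finite data from `D` and `Γ`. -/
theorem exists_skolem_step (hext : ExtensionProperty L X) (hhru : HrushovskiProperty L X)
    (P : ℕ → Set (Aut L X)) {D : Set X} {Γ : Set (Aut L X)} (hD : D.Countable)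
    (hΓ : Γ.Countable) :
    ∃ (D' : Set X) (Γ' : Set (Aut L X)), D'.Countable ∧ Γ'.Countable ∧ D ⊆ D' ∧ Γ ⊆ Γ' ∧
      (∀ γ ∈ Γ, ∀ x ∈ D, γ x ∈ D') ∧ (1 : Aut L X) ∈ Γ' ∧ (∀ γ ∈ Γ, γ⁻¹ ∈ Γ') ∧
      (∀ γ ∈ Γ, ∀ δ ∈ Γ, γ * δ ∈ Γ') ∧
      (∀ (n : ℕ) (c : Fin n → Aut L X) (F : Set X), (∀ i, c i ∈ Γ) → F.Finite → F ⊆ D →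
        ∃ F₂ : Set X, F₂.Finite ∧ F₂ ⊆ D' ∧ F ⊆ F₂ ∧ ∃ p : Fin n → Aut L X, (∀ i, p i ∈ Γ') ∧
          ∀ i, EqOn (p i) (c i) F ∧ Stabilises (p i) (closure L F₂)) ∧
      (∀ (n : ℕ) (c q : Fin n → Aut L X) (F F₁ F' : Set X), (∀ i, c i ∈ Γ) →
        (∀ i, q i ∈ Γ) → F₁.Finite → F'.Finite → F₁ ⊆ D → F' ⊆ D → F ⊆ F₁ → F ⊆ F' →
        (∀ i, Stabilises (c i) (closure L F)) → (∀ i, Stabilises (c i) (closure L F₁)) →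
        (∀ i, Stabilises (q i) (closure L F')) → (∀ i, EqOn (q i) (c i) F) →
        ∃ g ∈ Γ', EqOn g id F ∧ ∃ r : Fin n → Aut L X, (∀ i, r i ∈ Γ') ∧
          ∀ i, EqOn (r i) (c i) F₁ ∧ ∀ x ∈ F', r i (g x) = g (q i x)) ∧
      (∀ (k : ℕ) (F : Set X), F.Finite → F ⊆ D → (∀ γ ∈ Γ', EqOn γ id F → γ ∈ P k) →
        ∀ g : Aut L X, EqOn g id F → g ∈ P k) := by
  have := hΓ.to_subtype
  let Fin' := {F : Set X // F.Finite ∧ F ⊆ D}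
  have : Countable Fin' := (countable_ofPred_finite_subset hD).to_subtype
  have h1 : ∀ i : Σ n : ℕ, (Fin n → Γ) × Fin', ∃ F₂ : Set X, F₂.Finite ∧ i.2.2.1 ⊆ F₂ ∧
      ∃ p : Fin i.1 → Aut L X,
        ∀ j, EqOn (p j) (i.2.1 j).1 i.2.2.1 ∧ Stabilises (p j) (closure L F₂) :=
    fun i => hhru.exists_stabilises (fun j => (i.2.1 j).1) i.2.2.2.1
  choose A hAfin hA p hp using h1
  let I := {i : Σ n : ℕ, (Fin n → Γ) × (Fin n → Γ) × Fin' × Fin' × Fin' //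
    i.2.2.2.1.1 ⊆ i.2.2.2.2.1.1 ∧ i.2.2.2.1.1 ⊆ i.2.2.2.2.2.1 ∧
    (∀ j, Stabilises (i.2.1 j).1 (closure L i.2.2.2.1.1)) ∧
    (∀ j, Stabilises (i.2.1 j).1 (closure L i.2.2.2.2.1.1)) ∧
    (∀ j, Stabilises (i.2.2.1 j).1 (closure L i.2.2.2.2.2.1)) ∧
    ∀ j, EqOn (i.2.2.1 j).1 (i.2.1 j).1 i.2.2.2.1.1}
  have h2 : ∀ i : I, ∃ g : Aut L X, EqOn g id i.1.2.2.2.1.1 ∧ ∃ r : Fin i.1.1 → Aut L X,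
      ∀ j, EqOn (r j) (i.1.2.1 j).1 i.1.2.2.2.2.1.1 ∧
        ∀ x ∈ i.1.2.2.2.2.2.1, r j (g x) = g ((i.1.2.2.1 j).1 x) := fun i =>
    hext.exists_amalgam hhru (fun j => (i.1.2.1 j).1) (fun j => (i.1.2.2.1 j).1)
      i.1.2.2.2.2.1.2.1 i.1.2.2.2.2.2.2.1 i.2.1 i.2.2.1 i.2.2.2.1 i.2.2.2.2.1 i.2.2.2.2.2.1
      i.2.2.2.2.2.2
  choose g hg r hr using h2
  let J := {i : ℕ × Fin' // ∃ k : Aut L X, EqOn k id i.2.1 ∧ k ∉ P i.1}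
  have h3 : ∀ i : J, ∃ k : Aut L X, EqOn k id i.1.2.1 ∧ k ∉ P i.1.1 := fun i => i.2
  choose b hb using h3
  refine ⟨D ∪ image2 (fun γ x => (γ : Aut L X) x) Γ D ∪ ⋃ i, A i,
    Γ ∪ {1} ∪ Inv.inv '' Γ ∪ image2 (· * ·) Γ Γ ∪ (⋃ i, range (p i)) ∪ range g ∪
      (⋃ i, range (r i)) ∪ range b, ?_, ?_, ?_, ?_, ?_, ?_, ?_, ?_, ?_, ?_, ?_⟩
  · exact (hD.union (hΓ.image2 hD _)).union (countable_iUnion fun i => (hAfin i).countable)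
  · exact (((((((hΓ.union (countable_singleton _)).union (hΓ.image _)).union
      (hΓ.image2 hΓ _)).union (countable_iUnion fun i => countable_range _)).union
      (countable_range _)).union (countable_iUnion fun i => countable_range _)).union
      (countable_range _))
  · exact fun x hx => Or.inl (Or.inl hx)
  · intro γ hγ; simp [hγ]
  · exact fun γ hγ x hx => Or.inl (Or.inr (mem_image2_of_mem hγ hx))
  · simp
  · exact fun γ hγ => Or.inl (Or.inl (Or.inl (Or.inl (Or.inl (Or.inr (mem_image_of_mem _ hγ))))))
  · exact fun γ hγ δ hδ => Or.inl (Or.inl (Or.inl (Or.inl (Or.inr (mem_image2_of_mem hγ hδ)))))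
  · intro n c F hc hF hFD
    let i : Σ n : ℕ, (Fin n → Γ) × Fin' := ⟨n, fun j => ⟨c j, hc j⟩, ⟨F, hF, hFD⟩⟩
    exact ⟨A i, hAfin i, fun x hx => Or.inr (mem_iUnion.2 ⟨i, hx⟩), hA i, p i,
      fun j => Or.inl (Or.inl (Or.inl (Or.inr (mem_iUnion.2 ⟨i, mem_range_self j⟩)))), hp i⟩
  · intro n c q F F₁ F' hc hq hF₁ hF' hF₁D hF'D h₁ h' s₁ s₂ s₃ s₄
    let i : I := ⟨⟨n, fun j => ⟨c j, hc j⟩, fun j => ⟨q j, hq j⟩,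
      ⟨F, hF₁.subset h₁, h₁.trans hF₁D⟩, ⟨F₁, hF₁, hF₁D⟩, ⟨F', hF', hF'D⟩⟩,
      h₁, h', s₁, s₂, s₃, s₄⟩
    exact ⟨g i, Or.inl (Or.inl (Or.inr (mem_range_self i))), hg i, r i,
      fun j => Or.inl (Or.inr (mem_iUnion.2 ⟨i, mem_range_self j⟩)), hr i⟩
  · intro k F hF hFD hall
    by_contra! hcon
    let i : J := ⟨(k, ⟨F, hF, hFD⟩), hcon⟩
    exact (hb i).2 (hall (b i) (Or.inr (mem_range_self i)) (hb i).1)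

theorem exists_subset_of_finite_of_monotone {α : Type*} {S : ℕ → Set α} (hS : Monotone S)
    {F : Set α} (hF : F.Finite) (h : F ⊆ ⋃ n, S n) : ∃ n, F ⊆ S n := by
  obtain ⟨n, hn⟩ := hS.directed_le.exists_mem_subset_of_finset_subset_biUnion (s := hF.toFinset)
    (by simpa using h)
  exact ⟨n, by simpa using hn⟩

theorem nonempty_skolemSystem [MetricSpace X] [SeparableSpace X] (hext : ExtensionProperty L X)
    (hhru : HrushovskiProperty L X) (P : ℕ → Set (Aut L X)) :
    Nonempty (SkolemSystem L X P) := by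
  obtain ⟨D₀, hD₀c, hD₀⟩ := exists_countable_dense X
  choose stepD stepΓ hstep using fun (s : {s : Set X × Set (Aut L X) // s.1.Countable ∧
    s.2.Countable}) => exists_skolem_step hext hhru P s.2.1 s.2.2
  let st : ℕ → {s : Set X × Set (Aut L X) // s.1.Countable ∧ s.2.Countable} := fun n =>
    Nat.rec ⟨(D₀, ∅), hD₀c, countable_empty⟩
      (fun _ s => ⟨(stepD s, stepΓ s), (hstep s).1, (hstep s).2.1⟩) n
  let D : ℕ → Set X := fun n => (st n).1.1
  let Γ : ℕ → Set (Aut L X) := fun n => (st n).1.2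
  have hDm : Monotone D := monotone_nat_of_le_succ fun n => (hstep (st n)).2.2.1
  have hΓm : Monotone Γ := monotone_nat_of_le_succ fun n => (hstep (st n)).2.2.2.1
  have hs := fun n => (hstep (st n)).2.2.2.2
  have toΓ : ∀ n, Γ n ⊆ ⋃ n, Γ n := fun n => subset_iUnion Γ n
  have toD : ∀ n, D n ⊆ ⋃ n, D n := fun n => subset_iUnion D n
  have findD : ∀ {F : Set X}, F.Finite → F ⊆ ⋃ n, D n → ∃ n, F ⊆ D n := fun hF h =>
    exists_subset_of_finite_of_monotone hDm hF h
  have findΓ : ∀ {n : ℕ} {c : Fin n → Aut L X}, (∀ i, c i ∈ ⋃ n, Γ n) →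
      ∃ m, ∀ i, c i ∈ Γ m := by
    intro n c hc
    obtain ⟨m, hm⟩ := exists_subset_of_finite_of_monotone hΓm (finite_range c)
      (range_subset_iff.2 hc)
    exact ⟨m, fun i => hm (mem_range_self i)⟩
  let G : Subgroup (Aut L X) :=
    { carrier := ⋃ n, Γ n
      one_mem' := toΓ 1 (hs 0).2.1
      mul_mem' := by
        intro a b ha hb
        obtain ⟨m, hm⟩ := mem_iUnion.1 ha
        obtain ⟨k, hk⟩ := mem_iUnion.1 hb
        exact toΓ (max m k + 1) ((hs (max m k)).2.2.2.1 _ (hΓm (le_max_left _ _) hm) _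
          (hΓm (le_max_right _ _) hk))
      inv_mem' := by
        intro a ha
        obtain ⟨m, hm⟩ := mem_iUnion.1 ha
        exact toΓ (m + 1) ((hs m).2.2.1 _ hm) }
  refine ⟨⟨⋃ n, D n, G, countable_iUnion fun n => (st n).2.1, hD₀.mono (toD 0),
    countable_iUnion fun n => (st n).2.2, ?_, ?_, ?_, ?_⟩⟩
  · intro γ hγ x hx
    obtain ⟨m, hm⟩ := mem_iUnion.1 hγ
    obtain ⟨k, hk⟩ := mem_iUnion.1 hx
    exact toD (max m k + 1) ((hs (max m k)).1 _ (hΓm (le_max_left _ _) hm) _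
      (hDm (le_max_right _ _) hk))
  · intro n c F hc hF hFD
    obtain ⟨m, hm⟩ := findΓ hc
    obtain ⟨k, hk⟩ := findD hF hFD
    obtain ⟨F₂, h1, h2, h3, p, h4, h5⟩ := (hs (max m k)).2.2.2.2.1 n c F
      (fun i => hΓm (le_max_left _ _) (hm i)) hF (hk.trans (hDm (le_max_right _ _)))
    exact ⟨F₂, h1, h2.trans (toD (max m k + 1)), h3, p, fun i => toΓ (max m k + 1) (h4 i), h5⟩
  · intro n c q F F₁ F' hc hq hF₁ hF' hF₁D hF'D h₁ h' s₁ s₂ s₃ s₄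
    obtain ⟨m₁, hm₁⟩ := findΓ hc
    obtain ⟨m₂, hm₂⟩ := findΓ hq
    obtain ⟨k₁, hk₁⟩ := findD hF₁ hF₁D
    obtain ⟨k₂, hk₂⟩ := findD hF' hF'D
    let N := max (max m₁ m₂) (max k₁ k₂)
    obtain ⟨g, hg, hgF, r, hr, hr'⟩ := (hs N).2.2.2.2.2.1 n c q F F₁ F'
      (fun i => hΓm (show m₁ ≤ N by simp [N]) (hm₁ i))
      (fun i => hΓm (show m₂ ≤ N by simp [N]) (hm₂ i)) hF₁ hF'
      (hk₁.trans (hDm (show k₁ ≤ N by simp [N]))) (hk₂.trans (hDm (show k₂ ≤ N by simp [N])))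
      h₁ h' s₁ s₂ s₃ s₄
    exact ⟨g, toΓ (N + 1) hg, hgF, r, fun i => toΓ (N + 1) (hr i), hr'⟩
  · intro k F hF hFD hall
    obtain ⟨m, hm⟩ := findD hF hFD
    exact (hs m).2.2.2.2.2.2 k F hF hm fun γ hγ => hall γ (toΓ (m + 1) hγ)

end Skolem

/-! ### The limit group of a countable approximation -/

section LimitGroup

open FirstOrder.Language.Substructure

variable {L : FirstOrder.Language.{u, v}} {X : Type w} [L.Structure X] [MetricSpace X]
  {P : ℕ → Set (Aut L X)}

namespace SkolemSystem

/-- The automorphisms that are approximated on finite subsets of `D`, together with their inverses,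
by elements of `Γ`. -/
def subgroup (S : SkolemSystem L X P) : Subgroup (Aut L X) where
  carrier := {h | ∀ F : Set X, F.Finite → F ⊆ S.D → ∃ γ ∈ S.Γ, EqOn h γ F ∧
    EqOn (h⁻¹ : Aut L X) (γ⁻¹ : Aut L X) F}
  one_mem' := fun F _ _ => ⟨1, S.Γ.one_mem, fun _ _ => rfl, fun _ _ => rfl⟩
  inv_mem' := by
    intro h hh F hF hFD
    obtain ⟨γ, hγ, h1, h2⟩ := hh F hF hFD
    exact ⟨γ⁻¹, S.Γ.inv_mem hγ, h2, by simpa using h1⟩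
  mul_mem' := by
    intro a b ha hb F hF hFD
    have hbD : b '' F ⊆ S.D := by
      obtain ⟨γ, hγ, h1, -⟩ := hb F hF hFD
      rintro _ ⟨x, hx, rfl⟩
      rw [h1 hx]
      exact S.apply_mem γ hγ x (hFD hx)
    have haD : (a⁻¹ : Aut L X) '' F ⊆ S.D := by
      obtain ⟨γ, hγ, -, h1⟩ := ha F hF hFD
      rintro _ ⟨x, hx, rfl⟩
      rw [h1 hx]
      exact S.apply_mem _ (S.Γ.inv_mem hγ) x (hFD hx)
    obtain ⟨γ, hγ, h1, h2⟩ := ha (F ∪ b '' F) (hF.union (hF.image _)) (union_subset hFD hbD)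
    obtain ⟨δ, hδ, h3, h4⟩ := hb (F ∪ (a⁻¹ : Aut L X) '' F) (hF.union (hF.image _))
      (union_subset hFD haD)
    refine ⟨γ * δ, S.Γ.mul_mem hγ hδ, fun x hx => ?_, fun x hx => ?_⟩
    · rw [Aut.mul_apply, Aut.mul_apply, ← h3 (Or.inl hx), h1 (Or.inr (mem_image_of_mem _ hx))]
    · rw [mul_inv_rev, mul_inv_rev, Aut.mul_apply, Aut.mul_apply, ← h2 (Or.inl hx),
        h4 (Or.inr (mem_image_of_mem _ hx))]

/-- The group `S.subgroup` as a type of its own, which is given the topology of pointwise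
convergence on the discrete set `D`, finer than the one inherited from the automorphism group. -/
def Lim (S : SkolemSystem L X P) : Type w := S.subgroup

variable (S : SkolemSystem L X P)

instance : Group S.Lim := inferInstanceAs (Group S.subgroup)

/-- The inclusion of the limit group in the automorphism group. -/
def toAut : S.Lim →* Aut L X := S.subgroup.subtype

instance : CoeFun S.Lim (fun _ => X → X) := ⟨fun h => S.toAut h⟩

variable {S}

theorem toAut_injective : Function.Injective S.toAut := Subtype.val_injective

theorem mul_apply (g h : S.Lim) (x : X) : (g * h) x = g (h x) := by
  rw [map_mul, Aut.mul_apply]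

@[simp] theorem one_apply (x : X) : (1 : S.Lim) x = x := by
  rw [map_one, Aut.one_apply]

@[simp] theorem inv_apply_apply (g : S.Lim) (x : X) : g⁻¹ (g x) = x := by
  rw [map_inv, Aut.inv_apply_apply]

@[simp] theorem apply_inv_apply (g : S.Lim) (x : X) : g (g⁻¹ x) = x := by
  rw [map_inv, Aut.apply_inv_apply]

theorem inv_eqOn_id {g : S.Lim} {F : Set X} (h : EqOn g id F) : EqOn (g⁻¹ : S.Lim) id F := by
  intro x hx
  conv_lhs => rw [← id_eq x, ← h hx]
  exact inv_apply_apply g x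

/-- An element of `Γ` as an element of the limit group. -/
def ofΓ {γ : Aut L X} (hγ : γ ∈ S.Γ) : S.Lim :=
  ⟨γ, fun _ _ _ => ⟨γ, hγ, fun _ _ => rfl, fun _ _ => rfl⟩⟩

@[simp] theorem toAut_ofΓ {γ : Aut L X} (hγ : γ ∈ S.Γ) : S.toAut (ofΓ hγ) = γ := rfl

theorem exists_mem_Γ_eqOn (h : S.Lim) {F : Set X} (hF : F.Finite) (hFD : F ⊆ S.D) :
    ∃ γ ∈ S.Γ, EqOn γ h F := by
  obtain ⟨γ, hγ, h1, -⟩ := h.2 F hF hFD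
  exact ⟨γ, hγ, h1.symm⟩

theorem apply_mem_D (h : S.Lim) {x : X} (hx : x ∈ S.D) : h x ∈ S.D := by
  obtain ⟨γ, hγ, h1⟩ := exists_mem_Γ_eqOn h (finite_singleton x) (singleton_subset_iff.2 hx)
  rw [← h1 rfl]
  exact S.apply_mem γ hγ x hx

theorem image_subset_D (h : S.Lim) {F : Set X} (hF : F ⊆ S.D) : h '' F ⊆ S.D := by
  rintro _ ⟨x, hx, rfl⟩
  exact apply_mem_D h (hF hx)

end SkolemSystem

/-- A type synonym carrying the discrete topology. -/
def Discrete (X : Type w) : Type w := X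

instance : TopologicalSpace (Discrete X) := ⊥

instance : DiscreteTopology (Discrete X) := ⟨rfl⟩

namespace SkolemSystem

variable (S : SkolemSystem L X P)

/-- An element of the limit group, coded by its values and those of its inverse on `D`. -/
def code (h : S.Lim) : (S.D → Discrete X) × (S.D → Discrete X) :=
  (fun x => h x, fun x => h⁻¹ x)

instance : TopologicalSpace S.Lim := TopologicalSpace.induced S.code inferInstance

variable {S}

theorem eventually_apply_eq (h : S.Lim) {x : X} (hx : x ∈ S.D) : ∀ᶠ k in 𝓝 h, k x = h x := by
  have : Continuous fun k : S.Lim => (S.code k).1 ⟨x, hx⟩ :=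
    (continuous_apply (A := fun _ : S.D => Discrete X) _).comp
      (continuous_fst.comp continuous_induced_dom)
  have ht := this.tendsto h
  rw [nhds_discrete (Discrete X), tendsto_pure] at ht
  exact ht

theorem eventually_inv_apply_eq (h : S.Lim) {x : X} (hx : x ∈ S.D) :
    ∀ᶠ k in 𝓝 h, k⁻¹ x = h⁻¹ x := by
  have : Continuous fun k : S.Lim => (S.code k).2 ⟨x, hx⟩ :=
    (continuous_apply (A := fun _ : S.D => Discrete X) _).comp
      (continuous_snd.comp continuous_induced_dom)
  have ht := this.tendsto h
  rw [nhds_discrete (Discrete X), tendsto_pure] at ht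
  exact ht

theorem eventually_eqOn (h : S.Lim) {F : Set X} (hF : F.Finite) (hFD : F ⊆ S.D) :
    ∀ᶠ k in 𝓝 h, EqOn (S.toAut k) h F :=
  (eventually_all_finite hF).2 fun _ hx => eventually_apply_eq h (hFD hx)

theorem tendsto_nhds {α : Type*} {l : Filter α} {f : α → S.Lim} {h : S.Lim}
    (h1 : ∀ x ∈ S.D, ∀ᶠ a in l, f a x = h x) (h2 : ∀ x ∈ S.D, ∀ᶠ a in l, (f a)⁻¹ x = h⁻¹ x) :
    Tendsto f l (𝓝 h) := by
  rw [nhds_induced, tendsto_comap_iff, Prod.tendsto_iff]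
  constructor
  · refine tendsto_pi_nhds.2 fun x => ?_
    rw [nhds_discrete, tendsto_pure]
    exact h1 x x.2
  · refine tendsto_pi_nhds.2 fun x => ?_
    rw [nhds_discrete, tendsto_pure]
    exact h2 x x.2

instance : IsTopologicalGroup S.Lim where
  continuous_mul := by
    refine continuous_iff_continuousAt.2 fun ⟨g, h⟩ => tendsto_nhds (fun x hx => ?_) fun x hx => ?_
    · have e1 := (continuous_fst.tendsto (g, h)).eventually (eventually_apply_eq g (apply_mem_D h hx))
      have e2 := (continuous_snd.tendsto (g, h)).eventually (eventually_apply_eq h hx)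
      filter_upwards [e1, e2] with p hp1 hp2
      rw [mul_apply, mul_apply, hp2, hp1]
    · have e1 := (continuous_fst.tendsto (g, h)).eventually (eventually_inv_apply_eq g hx)
      have e2 := (continuous_snd.tendsto (g, h)).eventually
        (eventually_inv_apply_eq h (apply_mem_D g⁻¹ hx))
      filter_upwards [e1, e2] with p hp1 hp2
      rw [mul_inv_rev, mul_inv_rev, mul_apply, mul_apply, hp1, hp2]
  continuous_inv := by
    refine continuous_iff_continuousAt.2 fun h => tendsto_nhds
      (fun x hx => eventually_inv_apply_eq h hx) fun x hx => ?_
    filter_upwards [eventually_apply_eq h hx] with k hk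
    rw [inv_inv, inv_inv, hk]

theorem exists_finite_of_mem_nhds_one {V : Set S.Lim} (hV : V ∈ 𝓝 1) :
    ∃ F : Set X, F.Finite ∧ F ⊆ S.D ∧ ∀ v : S.Lim, EqOn v id F → v ∈ V := by
  rw [nhds_induced, mem_comap] at hV
  obtain ⟨t, ht, htV⟩ := hV
  obtain ⟨t₁, ht₁, t₂, ht₂, ht⟩ := mem_nhds_prod_iff.1 ht
  replace ht₁ : t₁ ∈ 𝓝 (S.code 1).1 := ht₁
  replace ht₂ : t₂ ∈ 𝓝 (S.code 1).2 := ht₂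
  rw [nhds_pi, Filter.mem_pi] at ht₁ ht₂
  obtain ⟨I, hI, s, hs, hst⟩ := ht₁
  obtain ⟨I', hI', s', hs', hst'⟩ := ht₂
  refine ⟨Subtype.val '' (I ∪ I'), (hI.union hI').image _, by rintro _ ⟨x, -, rfl⟩; exact x.2,
    fun v hv => htV (ht ⟨hst fun x hx => ?_, hst' fun x hx => ?_⟩)⟩
  · have h1 : v x = (1 : S.Lim) x := by
      rw [one_apply]; exact hv (mem_image_of_mem _ (Or.inl hx))
    have h2 : (S.code v).1 x = (S.code 1).1 x := h1
    rw [h2]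
    exact mem_of_mem_nhds (hs x)
  · have h1 : v⁻¹ x = (1⁻¹ : S.Lim) x := by
      rw [inv_one, one_apply]; exact inv_eqOn_id hv (mem_image_of_mem _ (Or.inr hx))
    have h2 : (S.code v).2 x = (S.code 1).2 x := h1
    rw [h2]
    exact mem_of_mem_nhds (hs' x)

theorem exists_finite_of_mem_nhds {h : S.Lim} {U : Set S.Lim} (hU : U ∈ 𝓝 h) :
    ∃ F : Set X, F.Finite ∧ F ⊆ S.D ∧ ∀ k : S.Lim, EqOn (S.toAut k) h F → k ∈ U := by
  have h1 : {v | h * v ∈ U} ∈ 𝓝 (1 : S.Lim) := by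
    have : Tendsto (fun v => h * v) (𝓝 (1 : S.Lim)) (𝓝 (h * 1)) :=
      (continuous_const.mul continuous_id).tendsto 1
    rw [mul_one] at this
    exact this hU
  obtain ⟨F, hF, hFD, hFU⟩ := exists_finite_of_mem_nhds_one h1
  refine ⟨F, hF, hFD, fun k hk => ?_⟩
  have h2 : h * (h⁻¹ * k) ∈ U := hFU (h⁻¹ * k) fun x hx => by
    rw [mul_apply, hk hx, inv_apply_apply, id_eq]
  simpa using h2

theorem isOpen_of_forall_eqOn {A : Set S.Lim} (h : ∀ a ∈ A, ∃ F : Set X, F.Finite ∧ F ⊆ S.D ∧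
    ∀ a' : S.Lim, EqOn (S.toAut a') a F → a' ∈ A) : IsOpen A := by
  refine isOpen_iff_mem_nhds.2 fun a ha => ?_
  obtain ⟨F, hF, hFD, hFA⟩ := h a ha
  filter_upwards [eventually_eqOn a hF hFD] with k hk using hFA k hk

theorem dense_of_forall_eqOn {A : Set S.Lim} (h : ∀ (a : S.Lim) (F : Set X), F.Finite → F ⊆ S.D →
    ∃ a' ∈ A, EqOn (S.toAut a') a F) : Dense A := by
  refine fun a => mem_closure_iff_nhds.2 fun U hU => ?_
  obtain ⟨F, hF, hFD, hFU⟩ := exists_finite_of_mem_nhds hU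
  obtain ⟨a', ha', he⟩ := h a F hF hFD
  exact ⟨a', hFU a' he, ha'⟩

instance : SeparableSpace S.Lim := by
  have := S.countable_Γ.to_subtype
  refine ⟨range fun γ : S.Γ => (ofΓ γ.2 : S.Lim), countable_range _,
    dense_of_forall_eqOn fun a F hF hFD => ?_⟩
  obtain ⟨γ, hγ, he⟩ := exists_mem_Γ_eqOn a hF hFD
  exact ⟨ofΓ hγ, ⟨⟨γ, hγ⟩, rfl⟩, he⟩

variable {ι : MetricStr.Ldist →ᴸ L}

/-- Completeness of the limit group: if `k` and `k⁻¹` are eventually constant at each point of `D`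
along a filter, then they converge to an element of the limit group and its inverse. -/
theorem exists_limit [CompleteSpace X] (hX : IsMetricStructure ι X) {l : Filter S.Lim} [NeBot l]
    (h1 : ∀ x ∈ S.D, ∃ y, ∀ᶠ k : S.Lim in l, k x = y)
    (h2 : ∀ x ∈ S.D, ∃ y, ∀ᶠ k : S.Lim in l, k⁻¹ x = y) :
    ∃ h : S.Lim, ∀ x ∈ S.D, (∀ᶠ k : S.Lim in l, k x = h x) ∧
      ∀ᶠ k : S.Lim in l, k⁻¹ x = h⁻¹ x := by
  obtain ⟨g, hg⟩ := hX.exists_tendsto S.dense_D (l := map S.toAut l)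
    (fun x hx => by
      obtain ⟨y, hy⟩ := h1 x hx
      exact ⟨y, tendsto_nhds_of_eventually_eq (eventually_map.2 hy)⟩)
    (fun x hx => by
      obtain ⟨y, hy⟩ := h2 x hx
      refine ⟨y, tendsto_nhds_of_eventually_eq (eventually_map.2 ?_)⟩
      simpa only [map_inv] using hy)
  have key : ∀ x ∈ S.D, (∀ᶠ k : S.Lim in l, k x = g x) ∧
      ∀ᶠ k : S.Lim in l, k⁻¹ x = g⁻¹ x := by
    intro x hx
    obtain ⟨y, hy⟩ := h1 x hx
    obtain ⟨y', hy'⟩ := h2 x hx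
    have e1 : y = g x := tendsto_nhds_unique
      (tendsto_nhds_of_eventually_eq (f := fun k : Aut L X => k x) (eventually_map.2 hy)) (hg x).1
    have e2 : y' = g⁻¹ x := tendsto_nhds_unique
      (tendsto_nhds_of_eventually_eq (f := fun k : Aut L X => k⁻¹ x)
        (eventually_map.2 (by simpa only [map_inv] using hy'))) (hg x).2
    exact ⟨e1 ▸ hy, e2 ▸ hy'⟩
  have hgS : g ∈ S.subgroup := by
    intro F hF hFD
    obtain ⟨k, hk⟩ := ((eventually_all_finite hF).2
      fun x hx => (key x (hFD hx)).1.and (key x (hFD hx)).2).exists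
    obtain ⟨γ, hγ, h3, h4⟩ := k.2 F hF hFD
    refine ⟨γ, hγ, fun x hx => ?_, fun x hx => ?_⟩
    · rw [← (hk x hx).1]; exact h3 hx
    · rw [← (hk x hx).2]; exact h4 hx
  exact ⟨⟨g, hgS⟩, key⟩

theorem isCompletelyMetrizableSpace [CompleteSpace X] (hX : IsMetricStructure ι X) :
    IsCompletelyMetrizableSpace S.Lim := by
  have := S.countable_D.to_subtype
  have hinj : Function.Injective S.code := fun g h hgh => toAut_injective
    (hX.eq_of_eqOn_dense S.dense_D fun x hx => congrFun (congrArg Prod.fst hgh) ⟨x, hx⟩)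
  refine (⟨⟨⟨rfl⟩, hinj⟩, isClosed_of_closure_subset fun p hp => ?_⟩ :
    IsClosedEmbedding S.code).IsCompletelyMetrizableSpace
  have hne : NeBot (comap S.code (𝓝 p)) :=
    comap_neBot_iff_frequently.2 (mem_closure_iff_frequently.1 hp)
  have e1 : ∀ x : S.D, ∀ᶠ k in comap S.code (𝓝 p), (S.code k).1 x = p.1 x := by
    intro x
    have := (((continuous_apply x).comp continuous_fst).tendsto p).comp
      (tendsto_comap (f := S.code))
    rwa [nhds_discrete (Discrete X), tendsto_pure] at this
  have e2 : ∀ x : S.D, ∀ᶠ k in comap S.code (𝓝 p), (S.code k).2 x = p.2 x := by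
    intro x
    have := (((continuous_apply x).comp continuous_snd).tendsto p).comp
      (tendsto_comap (f := S.code))
    rwa [nhds_discrete (Discrete X), tendsto_pure] at this
  obtain ⟨h, hh⟩ := exists_limit hX (l := comap S.code (𝓝 p))
    (fun x hx => ⟨p.1 ⟨x, hx⟩, e1 ⟨x, hx⟩⟩) (fun x hx => ⟨p.2 ⟨x, hx⟩, e2 ⟨x, hx⟩⟩)
  refine ⟨h, Prod.ext (funext fun x => ?_) (funext fun x => ?_)⟩
  · obtain ⟨k, hk1, hk2⟩ := ((hh x x.2).1.and (e1 x)).exists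
    exact hk1.symm.trans hk2
  · obtain ⟨k, hk1, hk2⟩ := ((hh x x.2).2.and (e2 x)).exists
    exact hk1.symm.trans hk2

theorem continuous_toAut (hX : IsMetricStructure ι X) : Continuous S.toAut := by
  refine continuous_iff_continuousAt.2 fun h => Aut.tendsto_nhds_iff.2 fun x => ?_
  rw [Metric.tendsto_nhds]
  intro ε hε
  obtain ⟨d, hdx, hd⟩ := Metric.dense_iff.1 S.dense_D x (ε / 2) (by positivity)
  rw [Metric.mem_ball] at hdx
  filter_upwards [eventually_apply_eq h hd] with k hk
  have h1 := dist_triangle (k x) (k d) (h x)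
  rw [hk] at h1
  have h2 := (hX.isometry (S.toAut k)).dist_eq x d
  rw [hk] at h2
  have h3 := (hX.isometry (S.toAut h)).dist_eq d x
  rw [h2, h3, dist_comm x d] at h1
  linarith

/-! ### Rich tuples -/

/-- A tuple `c` of the limit group is rich if `D` is exhausted by finitely generated substructures
invariant under `c`, and every extension of the action of `c` on such a substructure to a larger
finitely generated one is realised by `c`. Both conditions are about generators in `D`. -/
def Rich (S : SkolemSystem L X P) (n : ℕ) (c : Fin n → S.Lim) : Prop :=
  (∀ F : Set X, F.Finite → F ⊆ S.D → ∃ F₁ : Set X, F₁.Finite ∧ F₁ ⊆ S.D ∧ F ⊆ F₁ ∧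
    ∀ i, Stabilises (S.toAut (c i)) (closure L F₁)) ∧
  ∀ F F₁ : Set X, F₁.Finite → F₁ ⊆ S.D → F ⊆ F₁ → ∀ p : Fin n → Aut L X, (∀ i, p i ∈ S.Γ) →
    (∀ i, Stabilises (S.toAut (c i)) (closure L F)) → (∀ i, Stabilises (p i) (closure L F₁)) →
    (∀ i, EqOn (p i) (c i) F) →
    ∃ h : S.Lim, EqOn h id F ∧ ∀ i, ∀ z ∈ F₁, h (p i z) = c i (h z)

/-- The realisation condition of richness for extensions in the limit group rather than in `Γ`: only
their action on finitely many points matters. -/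
theorem Rich.exists_realisation {n : ℕ} {c : Fin n → S.Lim} (hc : S.Rich n c) {F F₁ : Set X}
    (hF₁ : F₁.Finite) (hF₁D : F₁ ⊆ S.D) (hFF₁ : F ⊆ F₁) (p : Fin n → S.Lim)
    (h1 : ∀ i, Stabilises (S.toAut (c i)) (closure L F))
    (h2 : ∀ i, Stabilises (S.toAut (p i)) (closure L F₁))
    (h3 : ∀ i, EqOn (S.toAut (p i)) (c i) F) :
    ∃ h : S.Lim, EqOn h id F ∧ ∀ i, ∀ z ∈ F₁, h (p i z) = c i (h z) := by
  choose γ hγ hγp using fun i => exists_mem_Γ_eqOn (p i) hF₁ hF₁D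
  obtain ⟨h, hF, hh⟩ := hc.2 F F₁ hF₁ hF₁D hFF₁ γ hγ h1
    (fun i => (h2 i).congr (Aut.eqOn_closure (hγp i).symm))
    (fun i x hx => (hγp i (hFF₁ hx)).trans (h3 i hx))
  exact ⟨h, hF, fun i z hz => by rw [← hh i z hz, hγp i hz]⟩

/-- A finite approximation of a conjugacy: `h` intertwines `c` and `c'` on `F`, which generates a
`c`-invariant substructure. -/
structure Intertwines {n : ℕ} (c c' : Fin n → S.Lim) (h : S.Lim) (F : Set X) : Prop where
  finite : F.Finite
  subset : F ⊆ S.D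
  stab : ∀ i, Stabilises (S.toAut (c i)) (closure L F)
  comm : ∀ i, ∀ x ∈ F, h (c i x) = c' i (h x)

/-- Conjugation by `h` exchanges the roles of the two tuples, so that the back step of the back and
forth is the forth step for the inverse. -/
theorem Intertwines.symm {n : ℕ} {c c' : Fin n → S.Lim} {h : S.Lim} {F : Set X}
    (H : Intertwines c c' h F) : Intertwines c' c h⁻¹ (h '' F) where
  finite := H.finite.image _
  subset := image_subset_D h H.subset
  stab i := (H.stab i).image (H.comm i)
  comm i := by
    rintro _ ⟨x, hx, rfl⟩
    rw [← H.comm i x hx, inv_apply_apply, inv_apply_apply]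

theorem Intertwines.forth {n : ℕ} {c c' : Fin n → S.Lim} {h : S.Lim} {F : Set X}
    (hc : S.Rich n c) (hc' : S.Rich n c') (H : Intertwines c c' h F) {x : X} (hx : x ∈ S.D) :
    ∃ (h' : S.Lim) (F' : Set X), Intertwines c c' h' F' ∧ F ⊆ F' ∧ x ∈ F' ∧
      EqOn (S.toAut h') h F := by
  obtain ⟨F₁, hF₁, hF₁D, hFF₁, hst⟩ := hc.1 (insert x F) (H.finite.insert x)
    (insert_subset hx H.subset)
  have hF : F ⊆ F₁ := (subset_insert x F).trans hFF₁
  obtain ⟨k, hkF, hk⟩ := hc'.exists_realisation (F := h '' F) (F₁ := h '' F₁) (hF₁.image _)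
    (image_subset_D h hF₁D) (image_mono hF) (fun i => h * c i * h⁻¹) H.symm.stab
    (fun i => (hst i).image fun z _ => by rw [mul_apply, mul_apply, inv_apply_apply])
    (fun i => by
      rintro _ ⟨z, hz, rfl⟩
      rw [mul_apply, mul_apply, inv_apply_apply, H.comm i z hz])
  refine ⟨k * h, F₁, ⟨hF₁, hF₁D, hst, fun i z hz => ?_⟩, hF, hFF₁ (mem_insert x F), fun z hz => ?_⟩
  · have := hk i (h z) (mem_image_of_mem _ hz)
    rw [mul_apply, mul_apply, inv_apply_apply] at this
    rw [mul_apply, mul_apply, this]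
  · rw [mul_apply, hkF (mem_image_of_mem _ hz), id_eq]

theorem Intertwines.forth_back {n : ℕ} {c c' : Fin n → S.Lim} {h : S.Lim} {F : Set X}
    (hc : S.Rich n c) (hc' : S.Rich n c') (H : Intertwines c c' h F) {x : X} (hx : x ∈ S.D) :
    ∃ (h' : S.Lim) (F' : Set X), Intertwines c c' h' F' ∧ F ⊆ F' ∧ x ∈ F' ∧ h'⁻¹ x ∈ F' ∧
      EqOn (S.toAut h') h F := by
  obtain ⟨h₁, F₁, H₁, hF₁, hx₁, he₁⟩ := H.forth hc hc' hx
  obtain ⟨k, F₂, H₂, hF₂, hx₂, he₂⟩ := H₁.symm.forth hc' hc hx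
  have hkz : ∀ z ∈ F₁, k (h₁ z) = z := fun z hz => by
    rw [he₂ (mem_image_of_mem _ hz), inv_apply_apply]
  have hsub : F₁ ⊆ k '' F₂ := fun z hz => ⟨h₁ z, hF₂ (mem_image_of_mem _ hz), hkz z hz⟩
  refine ⟨k⁻¹, k '' F₂, H₂.symm, hF₁.trans hsub, hsub hx₁, ?_, fun z hz => ?_⟩
  · rw [inv_inv]
    exact mem_image_of_mem _ hx₂
  · rw [← he₁ hz]
    conv_lhs => rw [← hkz z (hF₁ hz)]
    exact inv_apply_apply k _

/-- Back and forth: two rich tuples that agree on a finitely generated invariant substructure are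
conjugate by an element fixing it pointwise. -/
theorem Rich.exists_conj [CompleteSpace X] (hX : IsMetricStructure ι X) {n : ℕ}
    {c c' : Fin n → S.Lim} (hc : S.Rich n c) (hc' : S.Rich n c') {F : Set X} (hF : F.Finite)
    (hFD : F ⊆ S.D) (hst : ∀ i, Stabilises (S.toAut (c i)) (closure L F))
    (heq : ∀ i, EqOn (S.toAut (c i)) (c' i) F) :
    ∃ h : S.Lim, EqOn h id F ∧ ∀ i, h * c i * h⁻¹ = c' i := by
  rcases S.D.eq_empty_or_nonempty with hemp | hne
  · refine ⟨1, fun x _ => one_apply x, fun i => toAut_injective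
      (hX.eq_of_eqOn_dense S.dense_D ?_)⟩
    rw [hemp]
    exact fun x hx => absurd hx (notMem_empty x)
  obtain ⟨d, hd⟩ := S.countable_D.exists_eq_range hne
  have hdD : ∀ m, d m ∈ S.D := fun m => hd ▸ mem_range_self m
  let State := {s : S.Lim × Set X // Intertwines c c' s.1 s.2}
  choose nh nF nH nsub nmem nmem' neq using fun (s : State) (m : ℕ) =>
    s.2.forth_back hc hc' (hdD m)
  let st : ℕ → State := fun m => Nat.rec
    (⟨(1, F), hF, hFD, hst, fun i x hx => by rw [one_apply, one_apply, heq i hx]⟩ : State)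
    (fun m s => ⟨(nh s m, nF s m), nH s m⟩) m
  let h : ℕ → S.Lim := fun m => (st m).1.1
  let E : ℕ → Set X := fun m => (st m).1.2
  have hE : Monotone E := monotone_nat_of_le_succ fun m => nsub (st m) m
  have hEeq : ∀ m k, EqOn (S.toAut (h (m + k))) (h m) (E m) := by
    intro m k
    induction k with
    | zero => exact fun _ _ => rfl
    | succ k ih =>
      intro x hx
      rw [← ih hx]
      exact neq (st (m + k)) (m + k) (hE (Nat.le_add_right m k) hx)
  have hEeq' : ∀ {m k}, m ≤ k → ∀ {x}, x ∈ E m → h k x = h m x := by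
    intro m k hmk x hx
    obtain ⟨j, rfl⟩ := Nat.exists_eq_add_of_le hmk
    exact hEeq m j hx
  obtain ⟨g, hg⟩ := exists_limit hX (l := map h atTop)
    (fun x hx => by
      rw [hd] at hx
      obtain ⟨m, rfl⟩ := hx
      refine ⟨h (m + 1) (d m), eventually_map.2 ?_⟩
      filter_upwards [eventually_ge_atTop (m + 1)] with k hk
      exact hEeq' hk (nmem (st m) m))
    (fun x hx => by
      rw [hd] at hx
      obtain ⟨m, rfl⟩ := hx
      refine ⟨(h (m + 1))⁻¹ (d m), eventually_map.2 ?_⟩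
      filter_upwards [eventually_ge_atTop (m + 1)] with k hk
      have hmem : (h (m + 1))⁻¹ (d m) ∈ E (m + 1) := nmem' (st m) m
      have h1 := hEeq' hk hmem
      rw [apply_inv_apply] at h1
      conv_lhs => rw [← h1]
      exact inv_apply_apply _ _)
  have hgE : ∀ m, ∀ x ∈ E m, g x = h m x := by
    intro m x hx
    obtain ⟨k, hk1, hk2⟩ := ((eventually_map.1 (hg x ((st m).2.subset hx)).1).and
      (eventually_ge_atTop m)).exists
    rw [← hk1, hEeq' hk2 hx]
  refine ⟨g, fun x hx => by rw [hgE 0 x hx]; exact one_apply x, fun i => toAut_injective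
    (hX.eq_of_eqOn_dense S.dense_D fun x hx => ?_)⟩
  have key : ∀ y ∈ S.D, g (c i y) = c' i (g y) := by
    intro y hy
    rw [hd] at hy
    obtain ⟨m, rfl⟩ := hy
    have hmem : d m ∈ E (m + 1) := nmem (st m) m
    rw [hgE (m + 1) (d m) hmem, ← (st (m + 1)).2.comm i (d m) hmem]
    obtain ⟨k, hk1, hk2⟩ := ((eventually_map.1 (hg _ (apply_mem_D (c i) (hdD m))).1).and
      (eventually_ge_atTop (m + 1))).exists
    rw [← hk1, (st k).2.comm i (d m) (hE hk2 hmem), (st (m + 1)).2.comm i (d m) hmem]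
    exact congrArg _ (hEeq' hk2 hmem)
  have := key (g⁻¹ x) (apply_mem_D g⁻¹ hx)
  rw [apply_inv_apply] at this
  rw [mul_apply, mul_apply, this]

end SkolemSystem

end LimitGroup

section LimitGroupAmple

open FirstOrder.Language.Substructure

variable {L : FirstOrder.Language.{u, v}} {X : Type w} [L.Structure X] [MetricSpace X]
  {P : ℕ → Set (Aut L X)}

namespace SkolemSystem

variable {S : SkolemSystem L X P}

/-- Any `a` can be changed off a finite set so that, jointly with a rich tuple, it leaves invariant
a finitely generated substructure containing that set: the Hrushovski property provides such an
extension of the joint action, and richness realises it. -/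
theorem Rich.exists_eqOn_stabilises {n : ℕ} {c : Fin n → S.Lim} (hc : S.Rich n c) (a : S.Lim)
    {F : Set X} (hF : F.Finite) (hFD : F ⊆ S.D) :
    ∃ (a' : S.Lim) (F' : Set X), F'.Finite ∧ F' ⊆ S.D ∧ F ⊆ F' ∧ EqOn (S.toAut a') a F ∧
      Stabilises (S.toAut a') (closure L F') ∧ ∀ i, Stabilises (S.toAut (c i)) (closure L F') := by
  obtain ⟨F₁, hF₁, hF₁D, hFF₁, hst⟩ := hc.1 (F ∪ a '' F) (hF.union (hF.image _))
    (union_subset hFD (image_subset_D a hFD))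
  choose γ hγ hγe using fun i => exists_mem_Γ_eqOn ((Fin.cons a c : Fin (n + 1) → S.Lim) i)
    hF₁ hF₁D
  obtain ⟨F₂, hF₂, hF₂D, hF₁₂, p, hp, hpe⟩ := S.hrushovski (n + 1) γ F₁ hγ hF₁ hF₁D
  obtain ⟨h, hhF, hh⟩ := hc.2 F₁ F₂ hF₂ hF₂D hF₁₂ (fun i => p i.succ) (fun i => hp i.succ) hst
    (fun i => (hpe i.succ).2) (fun i => (hpe i.succ).1.trans (hγe i.succ))
  have hFsub : F ⊆ F₁ := subset_union_left.trans hFF₁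
  refine ⟨h * ofΓ (hp 0) * h⁻¹, h '' F₂, hF₂.image _, image_subset_D h hF₂D,
    fun x hx => ⟨x, hF₁₂ (hFsub hx), hhF (hFsub hx)⟩, fun x hx => ?_, ?_, fun i => ?_⟩
  · rw [mul_apply, mul_apply, inv_eqOn_id hhF (hFsub hx), id_eq, toAut_ofΓ, (hpe 0).1 (hFsub hx),
      hγe 0 (hFsub hx)]
    exact hhF (hFF₁ (Or.inr (mem_image_of_mem _ hx)))
  · refine (hpe 0).2.image fun x _ => ?_
    rw [mul_apply, mul_apply, inv_apply_apply, toAut_ofΓ]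
  · exact (hpe i.succ).2.image (hh i)

/-- Any `a` can be changed off a finite set so that, jointly with a rich tuple, it realises a given
extension of the joint action on `F`: amalgamate that extension with the action on a
finitely generated invariant substructure. -/
theorem Rich.exists_eqOn_realises {n : ℕ} {c : Fin n → S.Lim} (hc : S.Rich n c) {F F₁ : Set X}
    (hF₁ : F₁.Finite) (hF₁D : F₁ ⊆ S.D) (hFF₁ : F ⊆ F₁) {p : Fin (n + 1) → Aut L X}
    (hp : ∀ i, p i ∈ S.Γ) (hpst : ∀ i, Stabilises (p i) (closure L F₁)) (a : S.Lim)
    {F₀ : Set X} (hF₀ : F₀.Finite) (hF₀D : F₀ ⊆ S.D) :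
    ∃ a' : S.Lim, EqOn (S.toAut a') a F₀ ∧
      ((∀ i, Stabilises (S.toAut ((Fin.cons a' c : Fin (n + 1) → S.Lim) i)) (closure L F)) →
        (∀ i, EqOn (p i) ((Fin.cons a' c : Fin (n + 1) → S.Lim) i) F) →
        ∃ h : S.Lim, EqOn h id F ∧
          ∀ i, ∀ z ∈ F₁, h (p i z) = (Fin.cons a' c : Fin (n + 1) → S.Lim) i (h z)) := by
  obtain ⟨a₁, F₂, hF₂, hF₂D, hsub, ha₁, hast, hcst⟩ := hc.exists_eqOn_stabilises a
    (hF₀.union (hF₁.subset hFF₁)) (union_subset hF₀D (hFF₁.trans hF₁D))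
  let b : Fin (n + 1) → S.Lim := Fin.cons a₁ c
  by_cases hyp : (∀ i, Stabilises (S.toAut (b i)) (closure L F)) ∧ ∀ i, EqOn (p i) (b i) F
  swap
  · exact ⟨a₁, ha₁.mono subset_union_left, fun h1 h2 => absurd ⟨h1, h2⟩ hyp⟩
  have hFF₂ : F ⊆ F₂ := subset_union_right.trans hsub
  have hbst : ∀ i, Stabilises (S.toAut (b i)) (closure L F₂) := Fin.cases hast hcst
  choose γ hγ hγe using fun i => exists_mem_Γ_eqOn (b i) hF₂ hF₂D
  obtain ⟨g, hg, hgF, r, hr, hrr⟩ := S.amalgam (n + 1) γ p F F₂ F₁ hγ hp hF₂ hF₁ hF₂D hF₁D hFF₂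
    hFF₁ (fun i => (hyp.1 i).congr (Aut.eqOn_closure ((hγe i).mono hFF₂).symm))
    (fun i => (hbst i).congr (Aut.eqOn_closure (hγe i).symm)) hpst
    (fun i => (hyp.2 i).trans ((hγe i).mono hFF₂).symm)
  have hrb : ∀ i, EqOn (r i) (b i) F₂ := fun i => (hrr i).1.trans (hγe i)
  have hrst : ∀ i, Stabilises (r i) (closure L (F₂ ∪ g '' F₁)) := by
    intro i
    rw [Language.Substructure.closure_union]
    exact ((hbst i).congr (Aut.eqOn_closure (hrb i).symm)).sup
      ((hpst i).image fun x hx => ((hrr i).2 x hx).symm)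
  obtain ⟨k, hkF, hk⟩ := hc.2 F₂ (F₂ ∪ g '' F₁) (hF₂.union (hF₁.image _))
    (union_subset hF₂D (image_subset_D (ofΓ hg : S.Lim) hF₁D)) subset_union_left
    (fun i => r i.succ) (fun i => hr i.succ) hcst (fun i => hrst i.succ) (fun i => hrb i.succ)
  refine ⟨k * ofΓ (hr 0) * k⁻¹, fun x hx => ?_, fun _ _ => ⟨k * ofΓ hg, fun x hx => ?_, ?_⟩⟩
  · have hx₂ : x ∈ F₂ := hsub (Or.inl hx)
    rw [mul_apply, mul_apply, inv_eqOn_id hkF hx₂, id_eq, toAut_ofΓ, hrb 0 hx₂]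
    -- `k` fixes the substructure generated by `F₂`, which is invariant under `a₁`
    have h1 : EqOn (S.toAut k) (1 : Aut L X) (closure L F₂) := Aut.eqOn_closure hkF
    exact (h1 ((hast x).2 (subset_closure hx₂))).trans (ha₁ (Or.inl hx))
  · rw [mul_apply, toAut_ofΓ, hgF hx, id_eq, hkF (hFF₂ hx), id_eq]
  · refine Fin.cases (fun z hz => ?_) fun i z hz => ?_
    · rw [Fin.cons_zero, mul_apply, mul_apply, mul_apply, mul_apply, inv_apply_apply, toAut_ofΓ,
        toAut_ofΓ, (hrr 0).2 z hz]
    · rw [Fin.cons_succ, mul_apply, mul_apply, toAut_ofΓ, ← hk i (g z)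
        (Or.inr (mem_image_of_mem _ hz)), (hrr i.succ).2 z hz]

/-- Generic one-point extensions of a rich tuple are rich: richness is a countable conjunction of
conditions, each open and dense. -/
theorem Rich.eventually_rich_cons {n : ℕ} {c : Fin n → S.Lim} (hc : S.Rich n c) :
    ∀ᶠ a in residual S.Lim, S.Rich (n + 1) (Fin.cons a c) := by
  have hfin : {F : Set X | F.Finite ∧ F ⊆ S.D}.Countable :=
    countable_ofPred_finite_subset S.countable_D
  have hA : ∀ᶠ a in residual S.Lim, ∀ F ∈ {F : Set X | F.Finite ∧ F ⊆ S.D},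
      ∃ F₁ : Set X, F₁.Finite ∧ F₁ ⊆ S.D ∧ F ⊆ F₁ ∧ Stabilises (S.toAut a) (closure L F₁) ∧
        ∀ i, Stabilises (S.toAut (c i)) (closure L F₁) := by
    rw [eventually_countable_ball hfin]
    rintro F ⟨hF, hFD⟩
    refine residual_of_dense_open (isOpen_of_forall_eqOn ?_) (dense_of_forall_eqOn ?_)
    · rintro a ⟨F₁, hF₁, hF₁D, hFF₁, hst, hcst⟩
      exact ⟨F₁, hF₁, hF₁D, fun a' ha' =>
        ⟨F₁, hF₁, hF₁D, hFF₁, hst.congr (Aut.eqOn_closure ha'.symm), hcst⟩⟩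
    · intro a F₀ hF₀ hF₀D
      obtain ⟨a', F', hF', hF'D, hsub, he, hst, hcst⟩ := hc.exists_eqOn_stabilises a
        (hF.union hF₀) (union_subset hFD hF₀D)
      exact ⟨a', ⟨F', hF', hF'D, subset_union_left.trans hsub, hst, hcst⟩,
        he.mono subset_union_right⟩
  have hB : ∀ᶠ a in residual S.Lim, ∀ F ∈ {F : Set X | F.Finite ∧ F ⊆ S.D},
      ∀ F₁ ∈ {F : Set X | F.Finite ∧ F ⊆ S.D},
      ∀ p ∈ {p : Fin (n + 1) → Aut L X | ∀ i, p i ∈ (S.Γ : Set (Aut L X))}, F ⊆ F₁ →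
      (∀ i, Stabilises (p i) (closure L F₁)) →
      (∀ i, Stabilises (S.toAut ((Fin.cons a c : Fin (n + 1) → S.Lim) i)) (closure L F)) →
      (∀ i, EqOn (p i) ((Fin.cons a c : Fin (n + 1) → S.Lim) i) F) →
      ∃ h : S.Lim, EqOn h id F ∧
        ∀ i, ∀ z ∈ F₁, h (p i z) = (Fin.cons a c : Fin (n + 1) → S.Lim) i (h z) := by
    rw [eventually_countable_ball hfin]
    rintro F ⟨hF, hFD⟩
    rw [eventually_countable_ball hfin]
    rintro F₁ ⟨hF₁, hF₁D⟩
    rw [eventually_countable_ball (countable_pi fun _ => S.countable_Γ)]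
    intro p hp
    by_cases hFF₁ : F ⊆ F₁
    swap
    · exact Eventually.of_forall fun a h => absurd h hFF₁
    by_cases hpst : ∀ i, Stabilises (p i) (closure L F₁)
    swap
    · exact Eventually.of_forall fun a _ h => absurd h hpst
    refine residual_of_dense_open (isOpen_of_forall_eqOn ?_) (dense_of_forall_eqOn ?_)
    · intro a ha
      -- the hypotheses of the condition only depend on the values of `a` on `F`
      by_cases hyp : (∀ i, Stabilises (S.toAut ((Fin.cons a c : Fin (n + 1) → S.Lim) i))
          (closure L F)) ∧ ∀ i, EqOn (p i) ((Fin.cons a c : Fin (n + 1) → S.Lim) i) F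
      · obtain ⟨h, hhF, hh⟩ := ha hFF₁ hpst hyp.1 hyp.2
        refine ⟨h '' F₁, hF₁.image _, image_subset_D h hF₁D,
          fun a' ha' _ _ _ _ => ⟨h, hhF, ?_⟩⟩
        refine Fin.cases (fun z hz => ?_) fun i z hz => hh i.succ z hz
        rw [hh 0 z hz, Fin.cons_zero, Fin.cons_zero, ha' (mem_image_of_mem _ hz)]
      · refine ⟨F, hF, hFD, fun a' ha' _ _ h1 h2 => absurd ⟨?_, ?_⟩ hyp⟩
        · refine Fin.cases ?_ fun i => h1 i.succ
          exact (h1 0).congr (Aut.eqOn_closure ha')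
        · refine Fin.cases ?_ fun i => h2 i.succ
          exact (h2 0).trans ha'
    · intro a F₀ hF₀ hF₀D
      obtain ⟨a', he, ha'⟩ := hc.exists_eqOn_realises hF₁ hF₁D hFF₁ hp hpst a hF₀ hF₀D
      exact ⟨a', fun _ _ => ha', he⟩
  filter_upwards [hA, hB] with a ha hb
  refine ⟨fun F hF hFD => ?_, fun F F₁ hF₁ hF₁D hFF₁ p hp h1 h2 h3 =>
    hb F ⟨hF₁.subset hFF₁, hFF₁.trans hF₁D⟩ F₁ ⟨hF₁, hF₁D⟩ p hp hFF₁ h2 h1 h3⟩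
  obtain ⟨F₁, hF₁, hF₁D, hFF₁, hst, hcst⟩ := ha F ⟨hF, hFD⟩
  exact ⟨F₁, hF₁, hF₁D, hFF₁, Fin.cases hst hcst⟩

theorem ampleGenerics [CompleteSpace X] {ι : MetricStr.Ldist →ᴸ L} (hX : IsMetricStructure ι X) :
    AmpleGenerics S.Rich where
  nil T := ⟨fun F hF hFD => ⟨F, hF, hFD, Subset.rfl, fun i => i.elim0⟩,
    fun F _ _ _ _ _ _ _ _ _ => ⟨1, fun x _ => one_apply x, fun i => i.elim0⟩⟩
  generic n T hT := hT.eventually_rich_cons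
  conj n T a ha V hV := by
    obtain ⟨F, hF, hFD, hFV⟩ := exists_finite_of_mem_nhds_one hV
    obtain ⟨F₁, hF₁, hF₁D, hFF₁, hst⟩ := ha.1 F hF hFD
    refine ⟨_, eventually_eqOn a hF₁ hF₁D, fun b hb hbR => ?_⟩
    obtain ⟨v, hvF, hv⟩ := hbR.exists_conj hX ha hF₁ hF₁D
      (Fin.cases ((hst 0).congr (Aut.eqOn_closure (EqOn.symm hb))) fun i => hst i.succ)
      (Fin.cases hb fun i _ _ => rfl)
    exact ⟨v, hFV v fun x hx => hvF (hFF₁ hx), fun i => hv i.succ, hv 0⟩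

end SkolemSystem

end LimitGroupAmple

/-! ### Countable covers of the automorphism group -/

section Covers

variable {L : FirstOrder.Language.{u, v}} {X : Type w} [L.Structure X] [MetricSpace X]
  {ι : MetricStr.Ldist →ᴸ L}

/-- In every countable cover of the automorphism group by translates, some `W n` is somewhere dense
and `((W n)⁻¹ * W n) ^ 6` contains the stabiliser of a finite set. -/
theorem exists_stabiliser_subset_pow [SeparableSpace X] [CompleteSpace X]
    (hX : IsMetricStructure ι X)
    (hext : ExtensionProperty L X) (hhru : HrushovskiProperty L X) {k h : ℕ → Aut L X}
    {W : ℕ → Set (Aut L X)} (hW : (⋃ n, (fun x => k n * x * h n) '' W n) = univ) :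
    ∃ n, ¬ IsNowhereDense (W n) ∧ ∃ F : Set X, F.Finite ∧
      ∀ g : Aut L X, EqOn g id F → g ∈ ((W n)⁻¹ * W n) ^ 6 := by
  have := hX.isTopologicalGroup
  have := hX.polishSpace
  let P : ℕ → Set (Aut L X) := fun n => {g | h n * g * (h n)⁻¹ ∈ ((W n)⁻¹ * W n) ^ 6}
  obtain ⟨S⟩ := nonempty_skolemSystem hext hhru P
  have := SkolemSystem.isCompletelyMetrizableSpace (S := S) hX
  let K : ℕ → Set (Aut L X) := fun n => (fun x => k n * x * h n) '' W n
  -- after a translation, the nowhere dense sets of the cover are meagre in the limit group too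
  obtain ⟨g, hg⟩ := exists_isMeagre_preimage_mul (SkolemSystem.continuous_toAut (S := S) hX)
    (M := ⋃ n ∈ {n | IsNowhereDense (K n)}, K n)
    (isMeagre_biUnion (Set.to_countable _) fun n hn => IsNowhereDense.isMeagre hn)
  let C : ℕ → Set S.Lim := fun n => {y | g * S.toAut y ∈ K n}
  obtain ⟨n, hn, hpow⟩ := (SkolemSystem.ampleGenerics (S := S) hX).exists_pow_mem_nhds_one (C := C)
    (eq_univ_of_forall fun y => by
      obtain ⟨n, hn⟩ := mem_iUnion.1 (hW.ge (mem_univ (g * S.toAut y)))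
      exact mem_iUnion.2 ⟨n, hn⟩)
  have hKn : ¬ IsNowhereDense (K n) := fun hK => hn <| by
    refine hg.mono fun y hy => ?_
    have hy' : g * S.toAut y ∈ ⋃ n ∈ {n | IsNowhereDense (K n)}, K n :=
      mem_biUnion (show n ∈ {n | IsNowhereDense (K n)} from hK) hy
    exact hy'
  have hWn : ¬ IsNowhereDense (W n) := fun hWn => hKn
    (((Homeomorph.mulLeft (k n)).trans (Homeomorph.mulRight (h n))).isInducing.isNowhereDense_image
      hWn)
  have hCW : ∀ m, ∀ y ∈ ((C n)⁻¹ * C n) ^ m,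
      h n * S.toAut y * (h n)⁻¹ ∈ ((W n)⁻¹ * W n) ^ m := by
    intro m
    induction m with
    | zero => intro y hy; simp only [pow_zero, Set.mem_one] at hy ⊢; simp [hy]
    | succ m ih =>
      intro y hy
      rw [pow_succ] at hy ⊢
      obtain ⟨y₁, hy₁, y₂, ⟨a, ha, b, hb, rfl⟩, rfl⟩ := hy
      obtain ⟨x₁, hx₁, e₁⟩ := Set.mem_inv.1 ha
      obtain ⟨x₂, hx₂, e₂⟩ := hb
      refine ⟨_, ih y₁ hy₁, x₁⁻¹ * x₂, Set.mul_mem_mul (Set.inv_mem_inv.2 hx₁) hx₂, ?_⟩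
      have e₁' : (S.toAut a)⁻¹ = g⁻¹ * (k n * x₁ * h n) := by
        rw [show k n * x₁ * h n = g * S.toAut a⁻¹ from e₁, map_inv]; group
      have e₂' : S.toAut b = g⁻¹ * (k n * x₂ * h n) := by
        rw [show k n * x₂ * h n = g * S.toAut b from e₂]; group
      have e₁'' : S.toAut a = (g⁻¹ * (k n * x₁ * h n))⁻¹ := by rw [← e₁', inv_inv]
      simp only [map_mul]
      rw [e₁'', e₂']
      group
  obtain ⟨F, hF, hFD, hFV⟩ := SkolemSystem.exists_finite_of_mem_nhds_one hpow
  have hP : ∀ g : Aut L X, EqOn g id F → g ∈ P n := S.reflect n F hF hFD fun γ hγ hγF =>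
    hCW 6 (SkolemSystem.ofΓ hγ) (hFV (SkolemSystem.ofΓ hγ) hγF)
  refine ⟨n, hWn, h n '' F, hF.image _, fun f hf => ?_⟩
  have h1 := hP ((h n)⁻¹ * f * h n) fun x hx => by
    rw [Aut.mul_apply, Aut.mul_apply, hf (mem_image_of_mem _ hx), id_eq, Aut.inv_apply_apply, id_eq]
  have h2 : h n * ((h n)⁻¹ * f * h n) * (h n)⁻¹ = f := by group
  rw [← h2]
  exact h1

/-- The orbit condition turns stabilisers into open sets: if `O(a / g a)` meets `O(f a / a)` then
`f` is a product of three elements of the stabiliser of `a` with `g` and `g⁻¹`. Hence, if `V`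
is dense near the identity and a power of `V` contains a stabiliser, then a larger power of `V` has
non-empty interior. The open set found is moreover close to the identity, so that a translate
of it by an element of `V` is a neighbourhood of the identity. -/
theorem interior_pow_nonempty (hX : IsMetricStructure ι X) [Nonempty X]
    {𝓑 : Set (Σ k : ℕ, Fin k → X)} (h𝓑 : IsBasis L 𝓑)
    (hint : ∀ a ∈ 𝓑, ∀ ε : ℝ, 0 < ε →
      (interior {p : Aut L X × Aut L X | p.1 ∈ nhd L a.2 ε ∧
        (orbitOver L a.2 (fun i => p.1 (a.2 i)) ∩
          orbitOver L (fun i => p.2 (a.2 i)) a.2).Nonempty}).Nonempty)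
    {V : Set (Aut L X)} (hVinv : V⁻¹ = V) (hV : closure V ∈ 𝓝 1) {F : Set X} (hF : F.Finite)
    (hFV : ∀ g : Aut L X, EqOn g id F → g ∈ V ^ 6) :
    (interior (V ^ 20)).Nonempty ∧ V ^ 21 ∈ 𝓝 (1 : Aut L X) := by
  have := hX.isTopologicalGroup
  -- a basic neighbourhood of the identity in which `V` is dense
  obtain ⟨I, hI, ε, hε, hIV⟩ : ∃ I : Set X, I.Finite ∧ ∃ ε : ℝ, 0 < ε ∧
      ∀ g : Aut L X, (∀ x ∈ I, dist (g x) x < ε) → g ∈ closure V := by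
    rw [nhds_induced, mem_comap] at hV
    obtain ⟨t, ht, htV⟩ := hV
    rw [nhds_pi, Filter.mem_pi] at ht
    obtain ⟨I, hI, s, hs, hst⟩ := ht
    choose δ hδ hδs using fun x => Metric.mem_nhds_iff.1 (hs x)
    obtain ⟨ε, hε, hεδ⟩ : ∃ ε : ℝ, 0 < ε ∧ ∀ x ∈ I, ε ≤ δ x := by
      rcases I.eq_empty_or_nonempty with rfl | hne
      · exact ⟨1, one_pos, by simp⟩
      · obtain ⟨x₀, -, hx₀⟩ := exists_min_image I δ hI hne
        exact ⟨δ x₀, hδ x₀, hx₀⟩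
    refine ⟨I, hI, ε, hε, fun g hg => htV (hst fun x hx => hδs x ?_)⟩
    exact (hg x hx).trans_le (hεδ x hx)
  obtain ⟨x₀⟩ := ‹Nonempty X›
  have hfin : (insert x₀ (F ∪ I)).Finite := (hF.union hI).insert x₀
  -- the basis turns the finite set `F ∪ I` into a single tuple `a` of the family `𝓑`
  obtain ⟨l, a₀, ha₀⟩ := Set.Finite.fin_param hfin
  have ha₀mem : ∀ x ∈ insert x₀ (F ∪ I), ∃ i, a₀ i = x := fun x hx => by
    rw [← ha₀.2] at hx; exact hx
  have hl : 1 ≤ l := by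
    obtain ⟨i, -⟩ := ha₀mem x₀ (mem_insert _ _)
    exact Nat.one_le_iff_ne_zero.2 fun h0 => (h0 ▸ i).elim0
  obtain ⟨⟨m, a⟩, haB, η, hη, hst, hnh⟩ := h𝓑.2 l hl a₀ ε hε
  have hstV : ∀ g ∈ stab L a, g ∈ V ^ 6 := by
    intro g hg
    refine hFV g fun x hx => ?_
    obtain ⟨i, rfl⟩ := ha₀mem x (Or.inr (Or.inl hx))
    exact hst hg i
  have hnhV : ∀ g ∈ nhd L a η, g ∈ closure V := by
    intro g hg
    refine hIV g fun x hx => ?_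
    obtain ⟨i, rfl⟩ := ha₀mem x (Or.inr (Or.inr hx))
    exact (dist_le_pi_dist (fun i => g (a₀ i)) a₀ i).trans_lt (hnh hg)
  have stab_inv : ∀ g ∈ stab L a, g⁻¹ ∈ stab L a := by
    intro g hg i
    conv_lhs => rw [← hg i]
    exact Aut.inv_apply_apply g _
  obtain ⟨⟨g₀, f₀⟩, hp⟩ := hint ⟨m, a⟩ haB (η / 2) (by positivity)
  obtain ⟨U₁, hU₁, U₂, hU₂, hU⟩ := mem_nhds_prod_iff.1 (mem_interior_iff_mem_nhds.1 hp)
  have hg₀ : g₀ ∈ nhd L a η :=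
    lt_trans (b := η / 2) (hU (mk_mem_prod (mem_of_mem_nhds hU₁) (mem_of_mem_nhds hU₂))).1
      (by linarith)
  obtain ⟨g, hgU, hgV⟩ := mem_closure_iff_nhds.1 (hnhV g₀ hg₀) U₁ hU₁
  -- a conjugate `s` by `g` of a stabilising element moves `f a` back to `a`, up to the stabiliser;
  -- as `s` fixes `g a`, it moves `a` by at most twice the distance from `a` to `g a`
  have key : ∀ f ∈ U₂, f ∈ V ^ 20 ∧ f ∈ nhd L a η := by
    intro f hf
    have hgf := hU (mk_mem_prod hgU hf)
    obtain ⟨hg, -, ⟨s, hs, rfl⟩, q, hq, hqs⟩ := hgf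
    have hg : dist (fun i => g (a i)) a < η / 2 := hg
    have hs : ∀ i, s (g (a i)) = g (a i) := hs
    have hqs : ∀ i, q (f (a i)) = s (a i) := fun i => congrFun hqs i
    have h1 : g⁻¹ * s * g ∈ stab L a := fun i => by
      rw [Aut.mul_apply, Aut.mul_apply, hs i, Aut.inv_apply_apply]
    have h2 : f⁻¹ * q⁻¹ * s ∈ stab L a := fun i => by
      rw [Aut.mul_apply, Aut.mul_apply, ← hqs i, Aut.inv_apply_apply, Aut.inv_apply_apply]
    constructor
    · have e : f = q⁻¹ * g * (g⁻¹ * s * g) * g⁻¹ * (f⁻¹ * q⁻¹ * s)⁻¹ := by group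
      have hpow : V ^ 20 = V ^ 6 * V * V ^ 6 * V * V ^ 6 := by
        simp only [← pow_succ, ← pow_add]
      rw [e, hpow]
      exact Set.mul_mem_mul (Set.mul_mem_mul (Set.mul_mem_mul (Set.mul_mem_mul
        (hstV _ (stab_inv q hq)) hgV) (hstV _ h1)) (by rw [← hVinv]; exact Set.inv_mem_inv.2 hgV))
        (hstV _ (stab_inv _ h2))
    · refine (dist_pi_lt_iff hη).2 fun i => ?_
      have hgi : dist (g (a i)) (a i) < η / 2 :=
        (dist_le_pi_dist (fun i => g (a i)) a i).trans_lt hg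
      have e1 : dist (f (a i)) (a i) = dist (s (a i)) (a i) := by
        rw [← (hX.isometry q).dist_eq, hqs i, hq i]
      have e2 : dist (s (a i)) (g (a i)) = dist (a i) (g (a i)) := by
        conv_lhs => rw [← hs i]
        exact (hX.isometry s).dist_eq _ _
      have e3 := dist_triangle (s (a i)) (g (a i)) (a i)
      rw [e2, dist_comm (a i)] at e3
      rw [e1]
      linarith
  have hU₂V : U₂ ⊆ V ^ 20 := fun f hf => (key f hf).1
  refine ⟨⟨f₀, mem_interior_iff_mem_nhds.2 (mem_of_superset hU₂ hU₂V)⟩, ?_⟩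
  have hU₂' : interior U₂ ∈ 𝓝 f₀ := interior_mem_nhds.2 hU₂
  obtain ⟨f, hfU, hfV⟩ := mem_closure_iff_nhds.1 (hnhV f₀ (key f₀ (mem_of_mem_nhds hU₂)).2) _ hU₂'
  have ht : Tendsto (fun u => u * f) (𝓝 (1 : Aut L X)) (𝓝 (1 * f)) :=
    (continuous_id.mul continuous_const).tendsto 1
  rw [one_mul] at ht
  filter_upwards [ht (isOpen_interior.mem_nhds hfU)] with u hu
  rw [pow_succ]
  exact ⟨u * f, hU₂V (interior_subset hu), f⁻¹, by rw [← hVinv]; exact Set.inv_mem_inv.2 hfV,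
    by simp⟩

end Covers

/-! ### Automatic continuity of Steinhaus groups -/

section Groups

variable {G : Type*} [Group G] [TopologicalSpace G] [IsTopologicalGroup G]

theorem exists_symm_pow_subset {U : Set G} (hU : U ∈ 𝓝 (1 : G)) (m : ℕ) :
    ∃ V ∈ 𝓝 (1 : G), V⁻¹ = V ∧ V ^ m ⊆ U := by
  induction m generalizing U with
  | zero =>
    refine ⟨univ, univ_mem, by simp, ?_⟩
    rw [pow_zero]
    exact Set.one_subset.2 (mem_of_mem_nhds hU)
  | succ m ih =>
    obtain ⟨V₀, hV₀, h₀⟩ := exists_nhds_one_split hU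
    obtain ⟨V₁, hV₁, hinv, hsub⟩ := ih hV₀
    refine ⟨V₁ ∩ (V₀ ∩ V₀⁻¹), inter_mem hV₁ (inter_mem hV₀ (inv_mem_nhds_one G hV₀)), ?_, ?_⟩
    · rw [Set.inter_inv, Set.inter_inv, hinv, inv_inv, inter_comm V₀⁻¹]
    · rw [pow_succ]
      rintro _ ⟨x, hx, y, hy, rfl⟩
      exact h₀ x (hsub (Set.pow_subset_pow_left inter_subset_left hx)) y hy.2.1

/-- Steinhaus groups have automatic continuity: the preimage of a small symmetric neighbourhood of
the identity is right `σ`-syndetic, as the target is second countable. -/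
theorem IsSteinhausWithExponent.hasAutomaticContinuity {m : ℕ}
    (hG : IsSteinhausWithExponent G m) : HasAutomaticContinuity.{_, z} G := by
  intro H _ _ _ _ π
  refine continuous_of_continuousAt_one π ?_
  rw [ContinuousAt, map_one]
  intro U hU
  obtain ⟨V, hV, hinv, hVU⟩ := exists_symm_pow_subset hU m
  obtain ⟨t, htc, htd⟩ := exists_countable_dense (range π)
  have hne : t.Nonempty := htd.nonempty_iff.2 ⟨⟨π 1, mem_range_self 1⟩⟩
  obtain ⟨e, he⟩ := htc.exists_eq_range hne
  choose f hf using fun n => (e n).2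
  have hsyn : IsRightSigmaSyndetic (π ⁻¹' V) := by
    refine ⟨f, eq_univ_of_forall fun g => ?_⟩
    have hc : Continuous fun y : range π => π g * (y : H)⁻¹ := by fun_prop
    have hmem : {y : range π | π g * (y : H)⁻¹ ∈ V} ∈ 𝓝 (⟨π g, mem_range_self g⟩ : range π) := by
      refine hc.tendsto _ ?_
      simpa using hV
    obtain ⟨y, hy, hyt⟩ := mem_closure_iff_nhds.1 (htd ⟨π g, mem_range_self g⟩) _ hmem
    rw [he] at hyt
    obtain ⟨n, rfl⟩ := hyt
    refine mem_iUnion.2 ⟨n, g * (f n)⁻¹, ?_, by simp⟩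
    rw [mem_preimage, map_mul, map_inv, hf n]
    exact hy
  have hW := hG.2 (π ⁻¹' V) (by
    ext x
    rw [Set.mem_inv, mem_preimage, mem_preimage, map_inv, ← Set.mem_inv, hinv])
    (by rw [mem_preimage, map_one]; exact mem_of_mem_nhds hV) hsyn
  refine mem_map.2 (mem_of_superset hW fun x hx => hVU ?_)
  have hpow : ∀ k, ∀ x ∈ (π ⁻¹' V) ^ k, π x ∈ V ^ k := by
    intro k
    induction k with
    | zero => intro x hx; simp only [pow_zero, Set.mem_one] at hx ⊢; rw [hx, map_one]
    | succ k ih =>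
      intro x hx
      rw [pow_succ] at hx ⊢
      obtain ⟨y, hy, w, hw, rfl⟩ := hx
      rw [map_mul]
      exact Set.mul_mem_mul (ih y hy) hw
  exact hpow m x hx

end Groups

end MetricStr

theorem mainTheorem1 {L : FirstOrder.Language.{u, v}} [Countable L.Symbols]
    (ι : MetricStr.Ldist →ᴸ L) (X : Type w) [L.Structure X] [MetricSpace X]
    [TopologicalSpace.SeparableSpace X] [CompleteSpace X]
    (hX : MetricStr.IsMetricStructure ι X)
    (hext : MetricStr.ExtensionProperty L X)
    (hhru : MetricStr.HrushovskiProperty L X)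
    (𝓑 : Set (Σ k : ℕ, Fin k → X)) (h𝓑 : MetricStr.IsBasis L 𝓑)
    (hint : ∀ a ∈ 𝓑, ∀ ε : ℝ, 0 < ε →
      (interior {p : MetricStr.Aut L X × MetricStr.Aut L X |
        p.1 ∈ MetricStr.nhd L a.2 ε ∧
        (MetricStr.orbitOver L a.2 (fun i => p.1 (a.2 i)) ∩
          MetricStr.orbitOver L (fun i => p.2 (a.2 i)) a.2).Nonempty}).Nonempty) :
    (∀ (k h : ℕ → MetricStr.Aut L X) (W : ℕ → Set (MetricStr.Aut L X)),
      (⋃ n, (fun x => k n * x * h n) '' W n) = univ →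
      ∃ n, (interior (((W n)⁻¹ * W n) ^ 32)).Nonempty) ∧
    MetricStr.IsSteinhausWithExponent (MetricStr.Aut L X) 64 ∧
    MetricStr.HasAutomaticContinuity.{_, z} (MetricStr.Aut L X) := by
  have := hX.isTopologicalGroup
  have key : ∀ (k h : ℕ → MetricStr.Aut L X) (W : ℕ → Set (MetricStr.Aut L X)),
      (⋃ n, (fun x => k n * x * h n) '' W n) = univ →
      ∃ n, (1 : MetricStr.Aut L X) ∈ (W n)⁻¹ * W n ∧
        (interior (((W n)⁻¹ * W n) ^ 20)).Nonempty ∧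
        ((W n)⁻¹ * W n) ^ 21 ∈ 𝓝 (1 : MetricStr.Aut L X) := by
    intro k h W hW
    have one_mem : ∀ {n}, (W n).Nonempty → (1 : MetricStr.Aut L X) ∈ (W n)⁻¹ * W n :=
      fun ⟨x, hx⟩ => ⟨x⁻¹, Set.inv_mem_inv.2 hx, x, hx, inv_mul_cancel x⟩
    rcases isEmpty_or_nonempty X with hemp | hne
    · -- the automorphism group of the empty structure is trivial
      have : Subsingleton (MetricStr.Aut L X) :=
        ⟨fun f g => FirstOrder.Language.Equiv.ext fun x => hemp.elim x⟩
      obtain ⟨n, x, hx, -⟩ := mem_iUnion.1 (hW.ge (mem_univ 1))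
      have hV := one_mem ⟨x, hx⟩
      have huniv : ∀ m, ((W n)⁻¹ * W n) ^ m = univ := fun m =>
        Subsingleton.eq_univ_of_nonempty ⟨1, Set.one_mem_pow hV⟩
      exact ⟨n, hV, by rw [huniv, interior_univ]; exact univ_nonempty, by
        rw [huniv]; exact Filter.univ_mem⟩
    · obtain ⟨n, hn, F, hF, hFV⟩ := MetricStr.exists_stabiliser_subset_pow hX hext hhru hW
      have hWne : (W n).Nonempty := by
        by_contra h
        rw [not_nonempty_iff_eq_empty] at h
        exact hn (h ▸ isNowhereDense_empty)
      obtain ⟨h1, h2⟩ := MetricStr.interior_pow_nonempty hX h𝓑 hint (by simp [mul_inv_rev])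
        (MetricStr.closure_inv_mul_mem_nhds_one hn) hF hFV
      exact ⟨n, one_mem hWne, h1, h2⟩
  have hst : MetricStr.IsSteinhausWithExponent (MetricStr.Aut L X) 64 := by
    refine ⟨by norm_num, fun W hinv hone ⟨f, hf⟩ => ?_⟩
    obtain ⟨-, -, -, hV⟩ := key (fun _ => 1) f (fun _ => W) (by simpa only [one_mul] using hf)
    rw [hinv, ← pow_two, ← pow_mul] at hV
    exact Filter.mem_of_superset hV (Set.pow_subset_pow_right hone (by norm_num))
  refine ⟨fun k h W hW => ?_, hst, hst.hasAutomaticContinuity⟩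
  obtain ⟨n, hone, hn, -⟩ := key k h W hW
  exact ⟨n, hn.mono (interior_mono (Set.pow_subset_pow_right hone (by norm_num)))⟩
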